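/- Let $\hbar,c,m>0$ and $Q\in\mathbb{R}\setminus\{0\}$. Let $H^1$ be the usual Sobolev space of functions $\psi:\mathbb{R}^3\to\mathbb{C}^2$, and let $D^1$ be the space of locally integrable $\mathbf A:\mathbb{R}^3\to\mathbb{R}^3$ whose distributional first order derivatives lie in $L^2$ and for which $\{\mathbf x : |\mathbf A(\mathbf x)|>t\}$ has finite Lebesgue measure for every $t>0$. For $\lambda>0$ put $$\mathcal S_\lambda=\{(\psi,\mathbf A)\in H^1\times D^1 : \|\psi\|_{L^2}^2=\lambda,\ \operatorname{div}\mathbf A=0\}.$$ Write $\nabla_{\mathrm S,\mathbf A}=i\hbar\nabla+\frac Qc\mathbf A$ and $\nabla_{\mathrm P,\mathbf A}=\boldsymbol\sigma\cdot\nabla_{\mathrm S,\mathbf A}$, where $\boldsymbol\sigma=(\sigma^1,\sigma^2,\sigma^3)$ are the Pauli matrices. For $j\in\{\mathrm S,\mathrm P\}$, $\mathbf v\in\mathbb{R}^3$ and $(\psi,\mathbf A)\in\mathcal S_\lambda$ set $$\mathscr E_j^{\mathbf v}(\psi,\mathbf A)=\frac1{2m}\|\nabla_{j,\mathbf A}\psi\|_{L^2}^2+\frac1{8\pi}\Bigl(\|\nabla\otimes\mathbf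 A\|_{L^2}^2-\bigl\|\bigl(\tfrac{\mathbf v}{c}\cdot\nabla\bigr)\mathbf A\bigr\|_{L^2}^2\Bigr)+(\psi,i\hbar\,\mathbf v\cdot\nabla\psi)_{L^2},$$ $$E_j(\mathbf v,\psi,\mathbf A)=\frac1{2m}\|\nabla_{j,\mathbf A}\psi\|_{L^2}^2+\frac{\lambda}{8\pi}\int_{\mathbb{R}^3}\Bigl(|\nabla\times\mathbf A|^2+\bigl|\bigl(\tfrac{\mathbf v}{c}\cdot\nabla\bigr)\mathbf A\bigr|^2\Bigr)\,d\mathbf x ,$$ where $\nabla\otimes\mathbf A$ denotes the $9$-vector of all first derivatives $\partial_kA^l$. Theorem. Let $j\in\{\mathrm S,\mathrm P\}$ and $\lambda>0$. Then there exist $\theta_j,\kappa_j>0$, depending only on $j,\lambda,\hbar,c,Q,m$, such that $$\Bigl|E_j(\mathbf v,\psi,\mathbf A)-\frac{m|\mathbf v|^2}{2}\lambda\Bigr|\le\kappa_j|\mathbf v|^3$$ for every $\mathbf v\in\mathbb{R}^3$ with $0<|\mathbf v|<\theta_j$ and every minimizer $(\psi,\mathbf A)$ of $\mathscr E_j^{\mathbf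 v}$ on $\mathcal S_\lambda$. -/

import Mathlib

open MeasureTheory
open scoped ContDiff

noncomputable section

namespace TravellingWave

/-- Physical space `ℝ³` with its Euclidean norm. -/
abbrev R3 : Type := EuclideanSpace ℝ (Fin 3)

/-- The spinor space `ℂ²` with its Hermitian inner product. -/
abbrev C2 : Type := EuclideanSpace ℂ (Fin 2)

/-- The two models: Maxwell-Schrödinger (`S`) and Maxwell-Pauli (`P`). -/
inductive Model : Type
  | S
  | P

section Weak

variable {F : Type*} [NormedAddCommGroup F] [NormedSpace ℝ F]

/-- `g` is the distributional `k`-th partial derivative of `f` on `ℝ³`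
(both being locally integrable functions). -/
structure HasWeakPartial (k : Fin 3) (f g : R3 → F) : Prop where
  locallyIntegrable : LocallyIntegrable f volume
  locallyIntegrable_deriv : LocallyIntegrable g volume
  integral_eq : ∀ φ : R3 → ℝ, ContDiff ℝ ∞ φ → HasCompactSupport φ →
    ∫ x, (fderiv ℝ φ x (EuclideanSpace.single k 1)) • f x = -∫ x, φ x • g x

/-- The weak partial derivative is unique up to null sets. -/
theorem HasWeakPartial.ae_eq [CompleteSpace F] {k : Fin 3} {f g h : R3 → F}
    (hg : HasWeakPartial k f g) (hh : HasWeakPartial k f h) : g =ᵐ[volume] h := by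
  refine ae_eq_of_integral_contDiff_smul_eq hg.locallyIntegrable_deriv
    hh.locallyIntegrable_deriv fun φ hφ hc => ?_
  have h1 := hg.integral_eq φ hφ hc
  have h2 := hh.integral_eq φ hφ hc
  exact neg_injective (h1.symm.trans h2)

open Classical in
/-- The `k`-th distributional partial derivative of `f`, as a function (determined up to null
sets; it is `0` by convention if the distributional derivative is not a function). -/
def weakPartial (k : Fin 3) (f : R3 → F) : R3 → F :=
  if h : ∃ g, HasWeakPartial k f g then h.choose else 0

theorem HasWeakPartial.weakPartial {k : Fin 3} {f g : R3 → F} (h : HasWeakPartial k f g) :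
    HasWeakPartial k f (weakPartial k f) := by
  have h' : ∃ g, HasWeakPartial k f g := ⟨g, h⟩
  rw [TravellingWave.weakPartial, dif_pos h']
  exact h'.choose_spec

/-- The Sobolev space `H¹(ℝ³; F)`. -/
structure MemH1 (f : R3 → F) : Prop where
  memLp : MemLp f 2 volume
  memLp_deriv : ∀ k, ∃ g, HasWeakPartial k f g ∧ MemLp g 2 volume

/-- The space `D¹(ℝ³; F)` of locally integrable functions with distributional first order
derivatives in `L²` that vanish at infinity in the measure sense. -/
structure MemD1 (f : R3 → F) : Prop where
  locallyIntegrable : LocallyIntegrable f volume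
  memLp_deriv : ∀ k, ∃ g, HasWeakPartial k f g ∧ MemLp g 2 volume
  vanish : ∀ t : ℝ, 0 < t → volume {x | t < ‖f x‖} < ⊤

/-- The squared `L²`-norm. -/
def normSqL2 (f : R3 → F) : ℝ := ∫ x, ‖f x‖ ^ 2

/-- The directional derivative `(v · ∇) f`. -/
def dirDeriv (v : R3) (f : R3 → F) (x : R3) : F := ∑ k, v k • weakPartial k f x

end Weak

/-- The divergence of a vector field. -/
def div (A : R3 → R3) (x : R3) : ℝ := ∑ k, weakPartial k A x k

/-- The curl of a vector field. -/
def curl (A : R3 → R3) (x : R3) : R3 :=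
  !₂[weakPartial 1 A x 2 - weakPartial 2 A x 1,
     weakPartial 2 A x 0 - weakPartial 0 A x 2,
     weakPartial 0 A x 1 - weakPartial 1 A x 0]

/-- The Pauli matrices `σ¹, σ², σ³`. -/
def pauli : Fin 3 → Matrix (Fin 2) (Fin 2) ℂ :=
  ![!![0, 1; 1, 0], !![0, -Complex.I; Complex.I, 0], !![1, 0; 0, -1]]

/-- The `k`-th component of the covariant derivative `∇_{S,A} ψ = iħ∇ψ + (Q/c) A ψ`. -/
def covDeriv (ħ c Q : ℝ) (A : R3 → R3) (ψ : R3 → C2) (k : Fin 3) (x : R3) : C2 :=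
  (Complex.I * (ħ : ℂ)) • weakPartial k ψ x + ((Q / c * A x k : ℝ) : ℂ) • ψ x

/-- `∇_{P,A} ψ = σ · ∇_{S,A} ψ`. -/
def pauliDeriv (ħ c Q : ℝ) (A : R3 → R3) (ψ : R3 → C2) (x : R3) : C2 :=
  ∑ k, Matrix.toEuclideanLin (pauli k) (covDeriv ħ c Q A ψ k x)

/-- `‖∇_{j,A} ψ‖²` in `L²`. -/
def kineticNormSq (ħ c Q : ℝ) (j : Model) (A : R3 → R3) (ψ : R3 → C2) : ℝ :=
  match j with
  | .S => ∑ k, normSqL2 (covDeriv ħ c Q A ψ k)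
  | .P => normSqL2 (pauliDeriv ħ c Q A ψ)

/-- The functional `ℰ_j^v(ψ, A)`. The last term `(ψ, iħ v·∇ψ)` is a real number for `ψ ∈ H¹`. -/
def functional (ħ c m Q : ℝ) (j : Model) (v : R3) (ψ : R3 → C2) (A : R3 → R3) : ℝ :=
  1 / (2 * m) * kineticNormSq ħ c Q j A ψ
    + 1 / (8 * Real.pi) *
      ((∑ k, normSqL2 (weakPartial k A)) - normSqL2 (dirDeriv (c⁻¹ • v) A))
    + (∫ x, inner ℂ (ψ x) ((Complex.I * (ħ : ℂ)) • dirDeriv v ψ x)).re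

/-- The constraint set `𝒮_λ`. -/
def constraintSet (lam : ℝ) : Set ((R3 → C2) × (R3 → R3)) :=
  {p | MemH1 p.1 ∧ MemD1 p.2 ∧ normSqL2 p.1 = lam ∧ div p.2 =ᵐ[volume] 0}

/-- `(ψ, A)` minimizes `ℰ_j^v` on `𝒮_λ`. -/
def IsMinimizer (ħ c m Q : ℝ) (j : Model) (lam : ℝ) (v : R3) (ψ : R3 → C2) (A : R3 → R3) :
    Prop :=
  (ψ, A) ∈ constraintSet lam ∧
    IsMinOn (fun p => functional ħ c m Q j v p.1 p.2) (constraintSet lam) (ψ, A)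

/-- The energy `E_j(v, ψ, A)` of the travelling wave with profile `(ψ, A)` and velocity `v`. The
field energy is multiplied by `‖ψ‖²`, which equals `λ` on `𝒮_λ`. -/
def energy (ħ c m Q : ℝ) (j : Model) (v : R3) (ψ : R3 → C2) (A : R3 → R3) : ℝ :=
  1 / (2 * m) * kineticNormSq ħ c Q j A ψ
    + 1 / (8 * Real.pi) * (∫ x, (‖curl A x‖ ^ 2 + ‖dirDeriv (c⁻¹ • v) A x‖ ^ 2)) * normSqL2 ψ

end TravellingWave

end

/-!
In the frame moving with the particle, the vector potential is shifted by the constant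
`(m c / Q) v`, so that the functional becomes `-m |v|² λ / 2` plus a nonnegative kinetic energy
`P / (2 m)` relative to the moving frame, plus the (for slow `v` coercive) field energy, minus the
interaction `(Q / c) ∫ v · A |ψ|²`. Wave packets of wavelength tending to infinity, boosted to
velocity `v`, bring the functional down to `-m |v|² λ / 2`; hence for a minimizer the relative
kinetic energy and the field energy are controlled by the interaction.

Let `s⁴` be the relative kinetic energy of the Schrödinger model and `y² = ‖∇ ⊗ A‖²`. The Sobolev
inequality, applied to `A` and, through the diamagnetic inequality, to `|ψ|`, bounds the interaction
by `C |v| y s`. The Lichnerowicz formula bounds `s⁴` by `P + C ‖curl A‖ ‖ψ‖₃ ‖ψ‖₆ ≤ P + C y s³`.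
For small `|v|` these inequalities bootstrap to `s² = O(|v|²)` and `P, y² = O(|v|⁴)`, and in the
energy the only contribution beyond `m |v|² λ / 2` of lower order than `|v|⁴` is the cross term,
which is `O(|v| s²) = O(|v|³)`.
-/

noncomputable section

namespace TravellingWave

open Filter Topology
open scoped ENNReal NNReal Convolution

/-! ### Mollification -/

section Mollification

theorem eLpNorm_integral_le_of_forall {α β G : Type*} [MeasurableSpace α] [MeasurableSpace β]
    [NormedAddCommGroup G] [NormedSpace ℝ G] {μ : Measure α} {ν : Measure β} [SFinite μ]
    [IsProbabilityMeasure ν] {p δ : ℝ≥0∞} (hp : 1 ≤ p) (hp' : p ≠ ⊤) {f : α → β → G}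
    (hf : AEStronglyMeasurable (Function.uncurry f) (μ.prod ν))
    (h : ∀ᵐ y ∂ν, eLpNorm (fun x => f x y) p μ ≤ δ) :
    eLpNorm (fun x => ∫ y, f x y ∂ν) p μ ≤ δ := by
  lift p to ℝ≥0 using hp'
  have hp0 : p ≠ 0 := by
    rintro rfl
    simp at hp
  have hsection : ∀ᵐ x ∂μ, ‖∫ y, f x y ∂ν‖ₑ ^ (p : ℝ) ≤ ∫⁻ y, ‖f x y‖ₑ ^ (p : ℝ) ∂ν := by
    filter_upwards [hf.prodMk_left] with x hx
    calc ‖∫ y, f x y ∂ν‖ₑ ^ (p : ℝ) ≤ eLpNorm (f x) 1 ν ^ (p : ℝ) := by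
          gcongr
          rw [eLpNorm_one_eq_lintegral_enorm]
          exact enorm_integral_le_lintegral_enorm _
      _ ≤ eLpNorm (f x) p ν ^ (p : ℝ) := by
          gcongr
          exact eLpNorm_le_eLpNorm_of_exponent_le hp hx
      _ = _ := eLpNorm_nnreal_pow_eq_lintegral hp0
  have hpow : eLpNorm (fun x => ∫ y, f x y ∂ν) p μ ^ (p : ℝ) ≤ δ ^ (p : ℝ) := by
    calc eLpNorm (fun x => ∫ y, f x y ∂ν) p μ ^ (p : ℝ)
        ≤ ∫⁻ x, ∫⁻ y, ‖f x y‖ₑ ^ (p : ℝ) ∂ν ∂μ := by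
          rw [eLpNorm_nnreal_pow_eq_lintegral hp0]
          exact lintegral_mono_ae hsection
      _ = ∫⁻ y, ∫⁻ x, ‖f x y‖ₑ ^ (p : ℝ) ∂μ ∂ν :=
          lintegral_lintegral_swap (hf.enorm.pow_const _)
      _ ≤ ∫⁻ _, δ ^ (p : ℝ) ∂ν := by
          refine lintegral_mono_ae (h.mono fun y hy => ?_)
          rw [← eLpNorm_nnreal_pow_eq_lintegral hp0]
          gcongr
      _ = δ ^ (p : ℝ) := by simp
  exact (ENNReal.rpow_le_rpow_iff (NNReal.coe_pos.2 (pos_iff_ne_zero.2 hp0))).1 hpow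

/-- A sequence of bump functions shrinking to the origin. -/
def shrinkingBump {E : Type*} [NormedAddCommGroup E] (n : ℕ) : ContDiffBump (0 : E) where
  rIn := 1 / (n + 1)
  rOut := 2 / (n + 1)
  rIn_pos := by positivity
  rIn_lt_rOut := by gcongr; norm_num

theorem tendsto_shrinkingBump_rOut {E : Type*} [NormedAddCommGroup E] :
    Tendsto (fun n => (shrinkingBump n : ContDiffBump (0 : E)).rOut) atTop (𝓝 0) := by
  simpa [shrinkingBump, div_eq_mul_inv] using
    (tendsto_one_div_add_atTop_nhds_zero_nat (𝕜 := ℝ)).const_mul 2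

variable {E F : Type*} [NormedAddCommGroup E] [NormedSpace ℝ E] [FiniteDimensional ℝ E]
  [MeasurableSpace E] [BorelSpace E] {μ : Measure E} [NormedAddCommGroup F]

theorem tendsto_eLpNorm_translate_sub [μ.IsAddHaarMeasure] {p : ℝ≥0∞} [Fact (1 ≤ p)]
    (hp : p ≠ ⊤) {f : E → F} (hf : MemLp f p μ) :
    Tendsto (fun y => eLpNorm (fun x => f (x - y) - f x) p μ) (𝓝 0) (𝓝 0) := by
  let shift : E → C(E, E) := (ContinuousMap.mk (fun a : E × E => a.2 - a.1) (by fun_prop)).curry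
  have hshift : ∀ y, MeasurePreserving (shift y) μ μ := measurePreserving_sub_right μ
  have hcont : Continuous fun y => Lp.compMeasurePreserving (shift y) (hshift y) (hf.toLp f) :=
    continuous_const.compMeasurePreservingLp (ContinuousMap.continuous _) hshift hp
  refine (tendsto_iff_edist_tendsto_0.1 (hcont.tendsto 0)).congr fun y => ?_
  rw [Lp.toLp_compMeasurePreserving, Lp.toLp_compMeasurePreserving, Lp.edist_toLp_toLp]
  congr 1
  funext x
  simp [shift]

variable [NormedSpace ℝ F]

variable (μ) in
/-- The mollification of `f` by the normalised bump function `φ`. -/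
def mollify (φ : ContDiffBump (0 : E)) (f : E → F) : E → F :=
  φ.normed μ ⋆[ContinuousLinearMap.lsmul ℝ ℝ, μ] f

variable (μ) in
/-- The probability measure with density `φ` normalised with respect to `μ`: the mollification of
`f` at `x` is the mean of `f (x - ·)` for it. -/
def bumpMeasure (φ : ContDiffBump (0 : E)) : Measure E :=
  μ.withDensity fun y => ENNReal.ofReal (φ.normed μ y)

theorem integral_bumpMeasure (φ : ContDiffBump (0 : E)) (f : E → F) :
    ∫ y, f y ∂bumpMeasure μ φ = ∫ y, φ.normed μ y • f y ∂μ := by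
  rw [bumpMeasure, integral_withDensity_eq_integral_toReal_smul
    φ.continuous_normed.measurable.ennreal_ofReal (ae_of_all _ fun _ => ENNReal.ofReal_lt_top)]
  simp only [ENNReal.toReal_ofReal (φ.nonneg_normed _)]

variable [μ.IsAddHaarMeasure]

theorem contDiff_mollify (φ : ContDiffBump (0 : E)) {f : E → F}
    (hf : LocallyIntegrable f μ) : ContDiff ℝ ∞ (mollify μ φ f) :=
  φ.hasCompactSupport_normed.contDiff_convolution_left _ φ.contDiff_normed hf

theorem lintegral_ofReal_normed (φ : ContDiffBump (0 : E)) :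
    ∫⁻ y, ENNReal.ofReal (φ.normed μ y) ∂μ = 1 := by
  rw [← ofReal_integral_eq_lintegral_ofReal φ.integrable_normed (ae_of_all _ φ.nonneg_normed),
    φ.integral_normed, ENNReal.ofReal_one]

instance (φ : ContDiffBump (0 : E)) : IsProbabilityMeasure (bumpMeasure μ φ) :=
  ⟨by rw [bumpMeasure, withDensity_apply _ .univ, Measure.restrict_univ, lintegral_ofReal_normed]⟩

theorem integrable_bumpMeasure (φ : ContDiffBump (0 : E)) {f : E → F}
    (hf : LocallyIntegrable f μ) (x : E) : Integrable (fun y => f (x - y)) (bumpMeasure μ φ) := by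
  rw [bumpMeasure, integrable_withDensity_iff_integrable_smul'
    φ.continuous_normed.measurable.ennreal_ofReal (ae_of_all _ fun _ => ENNReal.ofReal_lt_top)]
  simp only [ENNReal.toReal_ofReal (φ.nonneg_normed _)]
  exact φ.hasCompactSupport_normed.convolutionExists_left (ContinuousLinearMap.lsmul ℝ ℝ)
    φ.continuous_normed hf x

theorem ae_bumpMeasure_norm_lt (φ : ContDiffBump (0 : E)) :
    ∀ᵐ y ∂bumpMeasure μ φ, ‖y‖ < φ.rOut := by
  rw [bumpMeasure, ae_withDensity_iff φ.continuous_normed.measurable.ennreal_ofReal]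
  refine ae_of_all _ fun y hy => ?_
  have hsupp : y ∈ Function.support (φ.normed μ) := fun h => hy (by rw [h, ENNReal.ofReal_zero])
  simpa [φ.support_normed_eq] using hsupp

theorem mollify_sub_apply [CompleteSpace F] (φ : ContDiffBump (0 : E)) {f : E → F}
    (hf : LocallyIntegrable f μ) (x : E) :
    mollify μ φ f x - f x = ∫ y, (f (x - y) - f x) ∂bumpMeasure μ φ := by
  rw [integral_sub (integrable_bumpMeasure φ hf x) (integrable_const _), integral_const,
    probReal_univ, one_smul, integral_bumpMeasure]
  rfl

theorem eLpNorm_mollify_sub_le [CompleteSpace F] {p : ℝ≥0∞} (hp : 1 ≤ p) (hp' : p ≠ ⊤)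
    (φ : ContDiffBump (0 : E)) {f : E → F} (hf : MemLp f p μ) {δ : ℝ≥0∞}
    (hδ : ∀ y, ‖y‖ < φ.rOut → eLpNorm (fun x => f (x - y) - f x) p μ ≤ δ) :
    eLpNorm (mollify μ φ f - f) p μ ≤ δ := by
  have hac : bumpMeasure μ φ ≪ μ := withDensity_absolutelyContinuous _ _
  have hprod : μ.prod (bumpMeasure μ φ) ≪ μ.prod μ := Measure.AbsolutelyContinuous.rfl.prod hac
  have htranslate : AEStronglyMeasurable (fun q : E × E => f (q.1 - q.2)) (μ.prod μ) :=
    hf.1.comp_quasiMeasurePreserving (quasiMeasurePreserving_sub_of_right_invariant μ μ)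
  have heq : mollify μ φ f - f = fun x => ∫ y, (f (x - y) - f x) ∂bumpMeasure μ φ :=
    funext (mollify_sub_apply φ (hf.locallyIntegrable hp))
  rw [heq]
  exact eLpNorm_integral_le_of_forall hp hp' ((htranslate.mono_ac hprod).sub hf.1.comp_fst)
    ((ae_bumpMeasure_norm_lt φ).mono hδ)

theorem tendsto_eLpNorm_mollify_sub [CompleteSpace F] {p : ℝ≥0∞} [Fact (1 ≤ p)] (hp : p ≠ ⊤)
    {f : E → F} (hf : MemLp f p μ) :
    Tendsto (fun n => eLpNorm (mollify μ (shrinkingBump n) f - f) p μ) atTop (𝓝 0) := by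
  rw [ENNReal.tendsto_nhds_zero]
  intro δ hδ
  have hnear := (ENNReal.tendsto_nhds_zero.1 (tendsto_eLpNorm_translate_sub hp hf)) δ hδ
  obtain ⟨r, hr, hball⟩ := Metric.eventually_nhds_iff.1 hnear
  filter_upwards [(tendsto_shrinkingBump_rOut (E := E)).eventually_lt_const hr] with n hn
  exact eLpNorm_mollify_sub_le Fact.out hp (shrinkingBump n) hf
    fun y hy => hball (by simpa using hy.trans hn)

theorem ae_tendsto_mollify [CompleteSpace F] {f : E → F} (hf : LocallyIntegrable f μ) :
    ∀ᵐ x ∂μ, Tendsto (fun n => mollify μ (shrinkingBump n) f x) atTop (𝓝 (f x)) := by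
  refine ContDiffBump.ae_convolution_tendsto_right_of_locallyIntegrable (K := 2)
    tendsto_shrinkingBump_rOut (Eventually.of_forall fun n => ?_) hf
  simp [shrinkingBump, div_eq_mul_inv]

theorem mollify_congr_of_ball (φ : ContDiffBump (0 : E)) {f g : E → F} {x : E}
    (h : ∀ y ∈ Metric.ball x φ.rOut, f y = g y) : mollify μ φ f x = mollify μ φ g x := by
  have hmean : ∀ u : E → F, mollify μ φ u x = ∫ y, u (x - y) ∂bumpMeasure μ φ :=
    fun u => (integral_bumpMeasure φ _).symm
  rw [hmean, hmean]
  refine integral_congr_ae ((ae_bumpMeasure_norm_lt φ).mono fun y hy => h _ ?_)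
  simpa [Metric.mem_ball, dist_eq_norm] using hy

theorem tendsto_setLIntegral_mollify_sub [CompleteSpace F] {f : E → F}
    (hf : LocallyIntegrable f μ) {K : Set E} (hK : IsCompact K) :
    Tendsto (fun n => ∫⁻ x in K, ‖mollify μ (shrinkingBump n) f x - f x‖ₑ ∂μ) atTop (𝓝 0) := by
  set L := Metric.cthickening 1 K
  have hL : IsCompact L := hK.cthickening
  have hcut : MemLp (L.indicator f) 1 μ :=
    memLp_one_iff_integrable.2
      ((hf.integrableOn_isCompact hL).integrable_indicator hL.measurableSet)
  refine tendsto_of_tendsto_of_tendsto_of_le_of_le' tendsto_const_nhds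
    (tendsto_eLpNorm_mollify_sub ENNReal.one_ne_top hcut)
    (Eventually.of_forall fun _ => zero_le) ?_
  filter_upwards [(tendsto_shrinkingBump_rOut (E := E)).eventually_lt_const one_pos] with n hn
  rw [eLpNorm_one_eq_lintegral_enorm]
  refine (setLIntegral_mono_ae' hK.measurableSet (ae_of_all _ fun x hx => ?_)).trans
    (setLIntegral_le_lintegral K _)
  have hball : ∀ y ∈ Metric.ball x (shrinkingBump n : ContDiffBump (0 : E)).rOut,
      f y = L.indicator f y := fun y hy =>
    (Set.indicator_of_mem (Metric.mem_cthickening_of_dist_le y x 1 K hx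
      ((Metric.mem_ball.1 hy).trans hn).le) f).symm
  rw [mollify_congr_of_ball _ hball, Pi.sub_apply,
    ← hball x (Metric.mem_ball_self (shrinkingBump n).rOut_pos)]

end Mollification

/-! ### Weak partial derivatives -/

theorem tendsto_zero_of_le_const_mul {u w : ℕ → ℝ≥0∞} {C : ℝ≥0∞} (hC : C ≠ ⊤)
    (hw : Tendsto w atTop (𝓝 0)) (h : ∀ n, u n ≤ C * w n) : Tendsto u atTop (𝓝 0) := by
  have hCw : Tendsto (fun n => C * w n) atTop (𝓝 0) := by
    simpa using ENNReal.Tendsto.const_mul hw (Or.inr hC)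
  exact tendsto_of_tendsto_of_tendsto_of_le_of_le tendsto_const_nhds hCw (fun _ => zero_le) h

theorem enorm_le_coe_mul_of_norm_le {F G : Type*} [NormedAddCommGroup F] [NormedAddCommGroup G]
    {C : ℝ≥0} {y : F} {z : G} (h : ‖y‖ ≤ C * ‖z‖) :
    ‖y‖ₑ ≤ C * ‖z‖ₑ := by
  simp only [enorm_eq_nnnorm]
  exact_mod_cast h

section WeakPartial

variable {F G : Type*} [NormedAddCommGroup F] [NormedSpace ℝ F]
  [NormedAddCommGroup G] [NormedSpace ℝ G] {k : Fin 3}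

/-- The classical `k`-th partial derivative. -/
def partialDeriv (k : Fin 3) (f : R3 → F) (x : R3) : F := fderiv ℝ f x (EuclideanSpace.single k 1)

theorem continuous_partialDeriv {f : R3 → F} (hf : ContDiff ℝ 1 f) :
    Continuous (partialDeriv k f) :=
  (hf.continuous_fderiv one_ne_zero).clm_apply continuous_const

theorem contDiff_partialDeriv {f : R3 → F} (hf : ContDiff ℝ ∞ f) :
    ContDiff ℝ ∞ (partialDeriv k f) :=
  (hf.fderiv_right (m := ∞) (by simp)).clm_apply contDiff_const

theorem hasCompactSupport_partialDeriv {f : R3 → F} (hf : HasCompactSupport f) :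
    HasCompactSupport (partialDeriv k f) :=
  hf.fderiv_apply ℝ _

theorem HasWeakPartial.of_contDiff {f : R3 → F} (hf : ContDiff ℝ 1 f) :
    HasWeakPartial k f (partialDeriv k f) where
  locallyIntegrable := hf.continuous.locallyIntegrable
  locallyIntegrable_deriv := (continuous_partialDeriv hf).locallyIntegrable
  integral_eq φ hφ hc := by
    have hφ1 : ContDiff ℝ 1 φ := hφ.of_le (by simp)
    have hint {w : R3 → F} (hw : Continuous w) {η : R3 → ℝ} (hη : Continuous η)
        (hηc : HasCompactSupport η) : Integrable fun x => η x • w x :=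
      hw.locallyIntegrable.integrable_smul_left_of_hasCompactSupport hη hηc
    exact (neg_eq_iff_eq_neg.2 (integral_smul_fderiv_eq_neg_fderiv_smul_of_integrable
      (hint hf.continuous (continuous_partialDeriv (k := k) hφ1)
        (hasCompactSupport_partialDeriv hc))
      (hint (continuous_partialDeriv (k := k) hf) hφ.continuous hc)
      (hint hf.continuous hφ.continuous hc)
      (fun x _ => hφ1.differentiable one_ne_zero x)
      (fun x _ => hf.differentiable one_ne_zero x))).symm

theorem weakPartial_ae_eq [CompleteSpace F] {f g : R3 → F} (h : HasWeakPartial k f g) :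
    weakPartial k f =ᵐ[volume] g :=
  h.weakPartial.ae_eq h

theorem partialDeriv_mollify (φ : ContDiffBump (0 : R3)) {f g : R3 → F}
    (h : HasWeakPartial k f g) :
    partialDeriv k (mollify volume φ f) = mollify volume φ g := by
  funext x
  set ρ : R3 → ℝ := φ.normed volume
  have hρ : ContDiff ℝ ∞ ρ := φ.contDiff_normed
  have hρc : HasCompactSupport ρ := φ.hasCompactSupport_normed
  have hderiv := hρc.hasFDerivAt_convolution_left (ContinuousLinearMap.lsmul ℝ ℝ)
    (hρ.of_le (by simp)) h.locallyIntegrable x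
  have hconv : Integrable (fun t =>
      ((ContinuousLinearMap.lsmul ℝ ℝ : ℝ →L[ℝ] F →L[ℝ] F).precompL R3)
        (fderiv ℝ ρ t) (f (x - t))) :=
    (hρc.fderiv ℝ).convolutionExists_left _ (hρ.continuous_fderiv (by simp)) h.locallyIntegrable x
  have hreflect : ∀ s, fderiv ℝ (fun s => ρ (x - s)) s (EuclideanSpace.single k 1) =
      -partialDeriv k ρ (x - s) := by
    intro s
    have hρx := (hρ.differentiable (by simp) (x - s)).hasFDerivAt
    have hcomp : HasFDerivAt (fun s => ρ (x - s)) _ s :=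
      hρx.comp s ((hasFDerivAt_id s).const_sub x)
    simp [hcomp.fderiv, partialDeriv]
  have hparts := h.integral_eq (fun s => ρ (x - s)) (hρ.comp (contDiff_const.sub contDiff_id))
    (hρc.comp_homeomorph (Homeomorph.subLeft x))
  simp only [hreflect, neg_smul, integral_neg, neg_inj] at hparts
  calc partialDeriv k (mollify volume φ f) x
      = ∫ t, partialDeriv k ρ t • f (x - t) := by
        rw [partialDeriv, mollify, hderiv.fderiv, convolution_def,
          ContinuousLinearMap.integral_apply hconv]
        rfl
    _ = ∫ s, partialDeriv k ρ (x - s) • f s := by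
        rw [← integral_sub_left_eq_self _ volume x]
        simp only [sub_sub_cancel]
    _ = ∫ s, ρ (x - s) • g s := hparts
    _ = mollify volume φ g x := by
        rw [mollify, convolution_eq_swap]
        rfl

/-- Convergence in `L¹` on every compact subset of `ℝ³`. -/
def TendstoL1Loc (u : ℕ → R3 → F) (f : R3 → F) : Prop :=
  ∀ K : Set R3, IsCompact K → Tendsto (fun n => ∫⁻ x in K, ‖u n x - f x‖ₑ) atTop (𝓝 0)

theorem tendstoL1Loc_mollify [CompleteSpace F] {f : R3 → F} (hf : LocallyIntegrable f) :
    TendstoL1Loc (fun n => mollify volume (shrinkingBump n) f) f :=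
  fun _ hK => tendsto_setLIntegral_mollify_sub hf hK

theorem TendstoL1Loc.tendsto_integral_smul {u : ℕ → R3 → F} {f : R3 → F} (h : TendstoL1Loc u f)
    (hu : ∀ n, LocallyIntegrable (u n)) (hf : LocallyIntegrable f) {η : R3 → ℝ}
    (hη : Continuous η) (hηc : HasCompactSupport η) :
    Tendsto (fun n => ∫ x, η x • u n x) atTop (𝓝 (∫ x, η x • f x)) := by
  obtain ⟨M, hM⟩ := hη.bounded_above_of_compact_support hηc
  refine tendsto_integral_of_L1 _
    (hf.integrable_smul_left_of_hasCompactSupport hη hηc).1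
    (Eventually.of_forall fun n => (hu n).integrable_smul_left_of_hasCompactSupport hη hηc)
    (tendsto_zero_of_le_const_mul (C := ENNReal.ofReal M) ENNReal.ofReal_ne_top (h _ hηc)
      fun n => ?_)
  rw [← setLIntegral_eq_of_support_subset (s := tsupport η),
    ← lintegral_const_mul' _ _ ENNReal.ofReal_ne_top]
  · refine lintegral_mono fun x => ?_
    rw [← smul_sub, enorm_smul, ← ofReal_norm]
    gcongr
    exact hM x
  · intro x hx
    refine subset_tsupport η fun h0 => hx ?_
    simp [h0]

theorem HasWeakPartial.of_tendsto {u w : ℕ → R3 → F} {f g : R3 → F}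
    (h : ∀ n, HasWeakPartial k (u n) (w n)) (hf : LocallyIntegrable f) (hg : LocallyIntegrable g)
    (hu : TendstoL1Loc u f) (hw : TendstoL1Loc w g) : HasWeakPartial k f g where
  locallyIntegrable := hf
  locallyIntegrable_deriv := hg
  integral_eq φ hφ hc := by
    refine tendsto_nhds_unique (hu.tendsto_integral_smul (fun n => (h n).locallyIntegrable) hf
      (continuous_partialDeriv (k := k) (hφ.of_le (by simp)))
      (hasCompactSupport_partialDeriv hc)) ?_
    refine ((hw.tendsto_integral_smul (fun n => (h n).locallyIntegrable_deriv) hg hφ.continuous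
      hc).neg).congr fun n => ?_
    exact ((h n).integral_eq φ hφ hc).symm

theorem norm_sub_le_of_norm_fderiv_le {Φ : F → G} (hΦ : ContDiff ℝ 1 Φ) {C : ℝ}
    (hC : ∀ z, ‖fderiv ℝ Φ z‖ ≤ C) (y z : F) : ‖Φ y - Φ z‖ ≤ C * ‖y - z‖ :=
  convex_univ.norm_image_sub_le_of_norm_fderiv_le
    (fun w _ => hΦ.differentiable one_ne_zero w) (fun w _ => hC w) trivial trivial

theorem aestronglyMeasurable_fderiv_comp_apply {Φ : F → G} (hΦ : ContDiff ℝ 1 Φ) {f g : R3 → F}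
    (hf : AEStronglyMeasurable f) (hg : AEStronglyMeasurable g) :
    AEStronglyMeasurable fun x => fderiv ℝ Φ (f x) (g x) :=
  (hΦ.continuous_fderiv_apply one_ne_zero).comp_aestronglyMeasurable (hf.prodMk hg)

theorem TendstoL1Loc.fderiv_comp_apply {Φ : F → G} (hΦ : ContDiff ℝ 1 Φ) {C : ℝ≥0}
    (hC : ∀ z, ‖fderiv ℝ Φ z‖ ≤ C) {u w : ℕ → R3 → F} {f g : R3 → F}
    (hu : ∀ n, AEStronglyMeasurable (u n)) (hf : AEStronglyMeasurable f)
    (hg : LocallyIntegrable g) (hlim : ∀ᵐ x, Tendsto (fun n => u n x) atTop (𝓝 (f x)))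
    (hw : TendstoL1Loc w g) :
    TendstoL1Loc (fun n x => fderiv ℝ Φ (u n x) (w n x)) fun x => fderiv ℝ Φ (f x) (g x) := by
  intro K hK
  have hbound : ∀ y z, ‖fderiv ℝ Φ y z‖ₑ ≤ C * ‖z‖ₑ := fun y z =>
    enorm_le_coe_mul_of_norm_le ((fderiv ℝ Φ y).le_of_opNorm_le (hC y) z)
  have hdom : Tendsto (fun n => ∫⁻ x in K, ‖fderiv ℝ Φ (u n x) (g x) - fderiv ℝ Φ (f x) (g x)‖ₑ)
      atTop (𝓝 0) := by
    rw [← lintegral_zero (μ := (volume : Measure R3).restrict K)]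
    refine tendsto_lintegral_of_dominated_convergence' (fun x => C * ‖g x‖ₑ + C * ‖g x‖ₑ)
      (fun n => ((aestronglyMeasurable_fderiv_comp_apply hΦ (hu n) hg.aestronglyMeasurable).sub
        (aestronglyMeasurable_fderiv_comp_apply hΦ hf hg.aestronglyMeasurable)).enorm.restrict)
      (fun n => ae_of_all _ fun x => ?_) ?_ (ae_restrict_of_ae (hlim.mono fun x hx => ?_))
    · exact enorm_sub_le.trans (add_le_add (hbound _ _) (hbound _ _))
    · rw [lintegral_add_left' (hg.aestronglyMeasurable.enorm.restrict.const_mul _),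
        lintegral_const_mul' _ _ ENNReal.coe_ne_top]
      have := (hg.integrableOn_isCompact hK).2.ne
      finiteness
    · have hcont := ((hΦ.continuous_fderiv one_ne_zero).clm_apply
        (continuous_const (y := g x))).tendsto (f x)
      simpa using ((hcont.comp hx).sub_const (fderiv ℝ Φ (f x) (g x))).enorm
  have hsum : Tendsto (fun n => C * (∫⁻ x in K, ‖w n x - g x‖ₑ) +
      ∫⁻ x in K, ‖fderiv ℝ Φ (u n x) (g x) - fderiv ℝ Φ (f x) (g x)‖ₑ) atTop (𝓝 0) := by
    simpa using (ENNReal.Tendsto.const_mul (hw K hK) (Or.inr ENNReal.coe_ne_top)).add hdom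
  refine tendsto_of_tendsto_of_tendsto_of_le_of_le tendsto_const_nhds hsum (fun _ => zero_le)
    fun n => ?_
  beta_reduce
  rw [← lintegral_const_mul' _ _ ENNReal.coe_ne_top, ← lintegral_add_right']
  · refine lintegral_mono fun x => ?_
    calc ‖fderiv ℝ Φ (u n x) (w n x) - fderiv ℝ Φ (f x) (g x)‖ₑ
        = ‖fderiv ℝ Φ (u n x) (w n x - g x)
            + (fderiv ℝ Φ (u n x) (g x) - fderiv ℝ Φ (f x) (g x))‖ₑ := by
          rw [map_sub, sub_add_sub_cancel]
      _ ≤ _ := (enorm_add_le _ _).trans (add_le_add_left (hbound _ _) _)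
  · exact ((aestronglyMeasurable_fderiv_comp_apply hΦ (hu n) hg.aestronglyMeasurable).sub
      (aestronglyMeasurable_fderiv_comp_apply hΦ hf hg.aestronglyMeasurable)).enorm.restrict

theorem HasWeakPartial.comp_contDiff [CompleteSpace F] {f g : R3 → F} (h : HasWeakPartial k f g)
    {Φ : F → G} (hΦ : ContDiff ℝ 1 Φ) {C : ℝ≥0} (hC : ∀ z, ‖fderiv ℝ Φ z‖ ≤ C) :
    HasWeakPartial k (fun x => Φ (f x)) fun x => fderiv ℝ Φ (f x) (g x) := by
  have hlip := norm_sub_le_of_norm_fderiv_le hΦ hC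
  set u : ℕ → R3 → F := fun n => mollify volume (shrinkingBump n) f
  have hu : ∀ n, ContDiff ℝ ∞ (u n) := fun n => contDiff_mollify _ h.locallyIntegrable
  have hf := h.locallyIntegrable.aestronglyMeasurable
  have hg := h.locallyIntegrable_deriv.aestronglyMeasurable
  have hpartial : ∀ n, HasWeakPartial k (fun x => Φ (u n x))
      fun x => fderiv ℝ Φ (u n x) (mollify volume (shrinkingBump n) g x) := by
    intro n
    have hΦu : ContDiff ℝ 1 fun x => Φ (u n x) := hΦ.comp ((hu n).of_le (by simp))
    convert HasWeakPartial.of_contDiff (k := k) hΦu using 2 with x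
    have hux : DifferentiableAt ℝ (u n) x := (hu n).differentiable (by simp) x
    rw [← partialDeriv_mollify _ h, partialDeriv, partialDeriv,
      fderiv_fun_comp x (hΦ.differentiable one_ne_zero _) hux]
    rfl
  refine .of_tendsto hpartial ?_ ?_ ?_ ?_
  · have hdiff : LocallyIntegrable fun x => Φ (f x) - Φ 0 := by
      refine (h.locallyIntegrable.smul (C : ℝ)).mono
        ((hΦ.continuous.comp_aestronglyMeasurable hf).sub aestronglyMeasurable_const)
        (ae_of_all _ fun x => ?_)
      simpa [norm_smul] using hlip (f x) 0
    simpa [Pi.add_def] using hdiff.add (locallyIntegrable_const (Φ 0))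
  · refine (h.locallyIntegrable_deriv.smul (C : ℝ)).mono
      (aestronglyMeasurable_fderiv_comp_apply hΦ hf hg) (ae_of_all _ fun x => ?_)
    simpa [norm_smul] using (fderiv ℝ Φ (f x)).le_of_opNorm_le (hC _) (g x)
  · intro K hK
    refine tendsto_zero_of_le_const_mul (C := C) ENNReal.coe_ne_top
      (tendstoL1Loc_mollify h.locallyIntegrable K hK) fun n => ?_
    rw [← lintegral_const_mul' _ _ ENNReal.coe_ne_top]
    exact lintegral_mono fun x => enorm_le_coe_mul_of_norm_le (hlip (u n x) (f x))
  · exact .fderiv_comp_apply hΦ hC (fun n => (hu n).continuous.aestronglyMeasurable) hf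
      h.locallyIntegrable_deriv (ae_tendsto_mollify h.locallyIntegrable)
      (tendstoL1Loc_mollify h.locallyIntegrable_deriv)

end WeakPartial

/-! ### Cutoffs and density of test functions -/

section Cutoff

variable {E : Type*} [NormedAddCommGroup E]

/-- A fixed bump function, equal to `1` on the unit ball and supported in the ball of radius
`2`. -/
def cutoffBump : ContDiffBump (0 : E) where
  rIn := 1
  rOut := 2
  rIn_pos := one_pos
  rIn_lt_rOut := one_lt_two

variable [NormedSpace ℝ E] [FiniteDimensional ℝ E]

/-- The smooth cutoff at scale `r`: equal to `1` on the ball of radius `r`, to `0` outside the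
ball of radius `2 r`. -/
def cutoff (r : ℝ) (x : E) : ℝ := (cutoffBump : ContDiffBump (0 : E)) (r⁻¹ • x)

theorem contDiff_cutoff (r : ℝ) : ContDiff ℝ ∞ (cutoff r : E → ℝ) :=
  cutoffBump.contDiff.comp (contDiff_const_smul _)

theorem hasCompactSupport_cutoff {r : ℝ} (hr : 0 < r) : HasCompactSupport (cutoff r : E → ℝ) :=
  cutoffBump.hasCompactSupport.comp_smul (inv_ne_zero hr.ne')

theorem cutoff_nonneg (r : ℝ) (x : E) : 0 ≤ cutoff r x := cutoffBump.nonneg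

theorem cutoff_le_one (r : ℝ) (x : E) : cutoff r x ≤ 1 := cutoffBump.le_one

theorem norm_cutoff_le_one (r : ℝ) (x : E) : ‖cutoff r x‖ ≤ 1 := by
  rw [Real.norm_of_nonneg (cutoff_nonneg r x)]
  exact cutoff_le_one r x

theorem cutoff_eq_one {r : ℝ} (hr : 0 < r) {x : E} (hx : ‖x‖ ≤ r) : cutoff r x = 1 := by
  refine cutoffBump.one_of_mem_closedBall ?_
  rw [mem_closedBall_zero_iff, norm_smul, norm_inv, Real.norm_of_nonneg hr.le]
  exact (inv_mul_le_iff₀ hr).2 (by simpa [cutoffBump] using hx)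

theorem cutoff_eq_zero {r : ℝ} (hr : 0 < r) {x : E} (hx : 2 * r ≤ ‖x‖) : cutoff r x = 0 := by
  refine cutoffBump.zero_of_le_dist ?_
  rw [dist_zero_right, norm_smul, norm_inv, Real.norm_of_nonneg hr.le, le_inv_mul_iff₀ hr]
  simpa [cutoffBump, mul_comm] using hx

theorem tendsto_cutoff (x : E) : Tendsto (fun n : ℕ => cutoff (n + 1 : ℝ) x) atTop (𝓝 1) := by
  refine tendsto_const_nhds.congr' ?_
  filter_upwards [eventually_ge_atTop ⌈‖x‖⌉₊] with n hn
  have hx : ‖x‖ ≤ n := Nat.ceil_le.1 hn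
  exact (cutoff_eq_one (by positivity) (by linarith)).symm

theorem fderiv_cutoff (r : ℝ) (x : E) :
    fderiv ℝ (cutoff r) x = r⁻¹ • fderiv ℝ (cutoffBump : ContDiffBump (0 : E)) (r⁻¹ • x) :=
  fderiv_comp_smul r⁻¹

theorem exists_norm_fderiv_cutoff_le (E : Type*) [NormedAddCommGroup E] [NormedSpace ℝ E]
    [FiniteDimensional ℝ E] :
    ∃ C : ℝ≥0, ∀ r : ℝ, 0 < r → ∀ x : E, ‖fderiv ℝ (cutoff r) x‖ ≤ C / r := by
  obtain ⟨C, hC⟩ := (((cutoffBump : ContDiffBump (0 : E)).contDiff (n := 1)).continuous_fderiv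
    one_ne_zero).bounded_above_of_compact_support (cutoffBump.hasCompactSupport.fderiv ℝ)
  refine ⟨C.toNNReal, fun r hr x => ?_⟩
  rw [fderiv_cutoff, norm_smul, norm_inv, Real.norm_of_nonneg hr.le, div_eq_inv_mul]
  gcongr
  exact (hC _).trans (Real.le_coe_toNNReal C)

end Cutoff

section LpLimits

variable {α F : Type*} [MeasurableSpace α] {μ : Measure α} [NormedAddCommGroup F]
  [NormedSpace ℝ F] {p : ℝ≥0∞}

theorem eLpNorm_smul_le_of_norm_le {a : α → ℝ} {M : ℝ≥0} (f : α → F) (ha : ∀ x, ‖a x‖ ≤ M) :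
    eLpNorm (fun x => a x • f x) p μ ≤ M * eLpNorm f p μ :=
  eLpNorm_le_nnreal_smul_eLpNorm_of_ae_le_mul
    (ae_of_all _ fun x => (nnnorm_smul_le _ _).trans (mul_le_mul_of_nonneg_right (ha x) zero_le)) p

theorem tendsto_eLpNorm_smul_of_ae_tendsto_zero (hp : p ≠ 0) (hp' : p ≠ ⊤) {a : ℕ → α → ℝ} {M : ℝ≥0}
    (ha : ∀ n, AEStronglyMeasurable (a n) μ) (hM : ∀ n x, ‖a n x‖ ≤ M)
    (hlim : ∀ᵐ x ∂μ, Tendsto (fun n => a n x) atTop (𝓝 0)) {f : α → F} (hf : MemLp f p μ) :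
    Tendsto (fun n => eLpNorm (fun x => a n x • f x) p μ) atTop (𝓝 0) := by
  lift p to ℝ≥0 using hp'
  have hp0 : p ≠ 0 := by exact_mod_cast hp
  have hpos : 0 < (p : ℝ) := NNReal.coe_pos.2 (pos_iff_ne_zero.2 hp0)
  have hpow : Tendsto (fun n => ∫⁻ x, ‖a n x • f x‖ₑ ^ (p : ℝ) ∂μ) atTop (𝓝 0) := by
    rw [← lintegral_zero (μ := μ)]
    refine tendsto_lintegral_of_dominated_convergence' (fun x => (M * ‖f x‖ₑ) ^ (p : ℝ))
      (fun n => ((ha n).smul hf.1).enorm.pow_const _) (fun n => ae_of_all _ fun x => ?_) ?_ ?_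
    · beta_reduce
      gcongr
      refine enorm_le_coe_mul_of_norm_le ((norm_smul_le _ _).trans ?_)
      gcongr
      exact hM n x
    · simp only [ENNReal.mul_rpow_of_nonneg _ _ hpos.le]
      rw [lintegral_const_mul' _ _ (by finiteness), ← eLpNorm_nnreal_pow_eq_lintegral hp0]
      have := hf.2.ne
      finiteness
    · filter_upwards [hlim] with x hx
      have hsmul := (ENNReal.continuous_rpow_const (y := p)).tendsto _ |>.comp
        (hx.smul_const (f x)).enorm
      simpa [Function.comp_def, ENNReal.zero_rpow_of_pos hpos] using hsmul
  simp only [← eLpNorm_nnreal_pow_eq_lintegral hp0] at hpow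
  have hroot := (ENNReal.continuous_rpow_const (y := (p : ℝ)⁻¹)).tendsto _ |>.comp hpow
  simpa [Function.comp_def, ENNReal.rpow_rpow_inv hpos.ne', hpos] using hroot

theorem tendsto_eLpNorm_smul_sub_const_smul [Fact (1 ≤ p)] (hp : p ≠ ⊤) {a : ℕ → α → ℝ} {b : ℝ}
    {M : ℝ≥0} (ha : ∀ n, AEStronglyMeasurable (a n) μ) (hM : ∀ n x, ‖a n x‖ ≤ M)
    (hlim : ∀ᵐ x ∂μ, Tendsto (fun n => a n x) atTop (𝓝 b)) {u : ℕ → α → F} {f : α → F}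
    (hu : ∀ n, AEStronglyMeasurable (u n) μ) (hf : MemLp f p μ)
    (huf : Tendsto (fun n => eLpNorm (u n - f) p μ) atTop (𝓝 0)) :
    Tendsto (fun n => eLpNorm (fun x => a n x • u n x - b • f x) p μ) atTop (𝓝 0) := by
  have hp1 : 1 ≤ p := Fact.out
  have hcoeff : Tendsto (fun n => eLpNorm (fun x => (a n x - b) • f x) p μ) atTop (𝓝 0) := by
    refine tendsto_eLpNorm_smul_of_ae_tendsto_zero (M := M + ‖b‖₊) (one_pos.trans_le hp1).ne' hp
      (fun n => (ha n).sub aestronglyMeasurable_const)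
      (fun n x => (norm_sub_le _ _).trans (add_le_add_left (hM n x) _)) ?_ hf
    filter_upwards [hlim] with x hx
    simpa using hx.sub_const b
  have hsum : Tendsto (fun n => M * eLpNorm (u n - f) p μ +
      eLpNorm (fun x => (a n x - b) • f x) p μ) atTop (𝓝 0) := by
    simpa using (ENNReal.Tendsto.const_mul huf (Or.inr ENNReal.coe_ne_top)).add hcoeff
  refine tendsto_of_tendsto_of_tendsto_of_le_of_le tendsto_const_nhds hsum (fun _ => zero_le)
    fun n => ?_
  calc eLpNorm (fun x => a n x • u n x - b • f x) p μ
      = eLpNorm ((fun x => a n x • (u n - f) x) + fun x => (a n x - b) • f x) p μ := by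
        congr 1
        funext x
        simp only [Pi.add_apply, Pi.sub_apply, smul_sub, sub_smul, sub_add_sub_cancel]
    _ ≤ eLpNorm (fun x => a n x • (u n - f) x) p μ + eLpNorm (fun x => (a n x - b) • f x) p μ :=
        eLpNorm_add_le ((ha n).smul ((hu n).sub hf.1))
          (((ha n).sub aestronglyMeasurable_const).smul hf.1) hp1
    _ ≤ _ := add_le_add_left (eLpNorm_smul_le_of_norm_le _ (hM n)) _

end LpLimits

section Density

variable {F : Type*} [NormedAddCommGroup F] [NormedSpace ℝ F]

theorem norm_partialDeriv_le {k : Fin 3} (f : R3 → F) (x : R3) :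
    ‖partialDeriv k f x‖ ≤ ‖fderiv ℝ f x‖ := by
  simpa [partialDeriv] using (fderiv ℝ f x).le_opNorm (EuclideanSpace.single k 1)

theorem partialDeriv_smul {k : Fin 3} {a : R3 → ℝ} {f : R3 → F} (ha : ContDiff ℝ 1 a)
    (hf : ContDiff ℝ 1 f) (x : R3) :
    partialDeriv k (fun x => a x • f x) x =
      a x • partialDeriv k f x + partialDeriv k a x • f x := by
  rw [partialDeriv, fderiv_fun_smul (ha.differentiable one_ne_zero x)
    (hf.differentiable one_ne_zero x)]
  rfl

/-- The compactly supported smooth functions approximating `f`: mollify, then cut off. -/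
def testApprox (f : R3 → F) (n : ℕ) (x : R3) : F :=
  cutoff (n + 1 : ℝ) x • mollify volume (shrinkingBump n) f x

theorem hasCompactSupport_testApprox (f : R3 → F) (n : ℕ) :
    HasCompactSupport (testApprox f n) :=
  (hasCompactSupport_cutoff (by positivity)).smul_right

theorem contDiff_testApprox {f : R3 → F} (hf : LocallyIntegrable f) (n : ℕ) :
    ContDiff ℝ ∞ (testApprox f n) :=
  (contDiff_cutoff _).smul (contDiff_mollify _ hf)

theorem partialDeriv_testApprox {k : Fin 3} {f g : R3 → F} (h : HasWeakPartial k f g) (n : ℕ)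
    (x : R3) : partialDeriv k (testApprox f n) x =
      cutoff (n + 1 : ℝ) x • mollify volume (shrinkingBump n) g x +
        partialDeriv k (cutoff (n + 1 : ℝ)) x • mollify volume (shrinkingBump n) f x := by
  rw [← partialDeriv_mollify _ h]
  exact partialDeriv_smul ((contDiff_cutoff _).of_le (by simp))
    ((contDiff_mollify _ h.locallyIntegrable).of_le (by simp)) x

variable [CompleteSpace F]

theorem tendsto_eLpNorm_testApprox_sub {p : ℝ≥0∞} [Fact (1 ≤ p)] (hp : p ≠ ⊤) {f : R3 → F}
    (hf : MemLp f p) : Tendsto (fun n => eLpNorm (testApprox f n - f) p) atTop (𝓝 0) := by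
  have hloc : LocallyIntegrable f := hf.locallyIntegrable Fact.out
  have hlim := tendsto_eLpNorm_smul_sub_const_smul (M := 1) hp
    (fun n => (contDiff_cutoff (n + 1 : ℝ)).continuous.aestronglyMeasurable)
    (fun n x => norm_cutoff_le_one (n + 1 : ℝ) x) (ae_of_all _ tendsto_cutoff)
    (fun n => (contDiff_mollify (shrinkingBump n) hloc).continuous.aestronglyMeasurable) hf
    (tendsto_eLpNorm_mollify_sub hp hf)
  simp only [one_smul] at hlim
  exact hlim

theorem tendsto_eLpNorm_partialDeriv_testApprox_sub {p : ℝ≥0∞} [Fact (1 ≤ p)] (hp : p ≠ ⊤)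
    {k : Fin 3} {f g : R3 → F} (h : HasWeakPartial k f g) (hf : MemLp f p) (hg : MemLp g p) :
    Tendsto (fun n => eLpNorm (partialDeriv k (testApprox f n) - g) p) atTop (𝓝 0) := by
  obtain ⟨C, hC⟩ := exists_norm_fderiv_cutoff_le R3
  have hmoll := fun n => contDiff_mollify (shrinkingBump n) h.locallyIntegrable
  have hmoll' := fun n => contDiff_mollify (shrinkingBump n) h.locallyIntegrable_deriv
  have hcut := fun n : ℕ => contDiff_cutoff (E := R3) (n + 1 : ℝ)
  have hpartial_le (n : ℕ) (x : R3) : ‖partialDeriv k (cutoff (n + 1 : ℝ)) x‖ ≤ C / (n + 1) :=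
    (norm_partialDeriv_le _ _).trans (hC _ (by positivity) x)
  have hpartial_lim (x : R3) :
      Tendsto (fun n : ℕ => partialDeriv k (cutoff (n + 1 : ℝ)) x) atTop (𝓝 0) := by
    refine squeeze_zero_norm (hpartial_le · x) ?_
    simpa [div_eq_mul_inv] using
      (tendsto_one_div_add_atTop_nhds_zero_nat (𝕜 := ℝ)).const_mul (C : ℝ)
  have hmain := tendsto_eLpNorm_smul_sub_const_smul (M := 1) hp
    (fun n => (hcut n).continuous.aestronglyMeasurable)
    (fun n x => norm_cutoff_le_one (n + 1 : ℝ) x) (ae_of_all _ tendsto_cutoff)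
    (fun n => (hmoll' n).continuous.aestronglyMeasurable) hg (tendsto_eLpNorm_mollify_sub hp hg)
  have herror := tendsto_eLpNorm_smul_sub_const_smul (M := C) hp
    (fun n => (continuous_partialDeriv ((hcut n).of_le (by simp))).aestronglyMeasurable)
    (fun n x => (hpartial_le n x).trans (div_le_self C.2 (by linarith [n.cast_nonneg (α := ℝ)])))
    (ae_of_all _ hpartial_lim)
    (fun n => (hmoll n).continuous.aestronglyMeasurable) hf (tendsto_eLpNorm_mollify_sub hp hf)
  simp only [one_smul] at hmain
  simp only [zero_smul, sub_zero] at herror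
  have hsum := hmain.add herror
  rw [add_zero] at hsum
  refine tendsto_of_tendsto_of_tendsto_of_le_of_le tendsto_const_nhds hsum (fun _ => zero_le)
    fun n => ?_
  refine le_trans (le_of_eq ?_) (eLpNorm_add_le
    (((hcut n).continuous.smul (hmoll' n).continuous).aestronglyMeasurable.sub hg.1)
    ((continuous_partialDeriv ((hcut n).of_le (by simp))).smul
      (hmoll n).continuous).aestronglyMeasurable Fact.out)
  congr 1
  funext x
  rw [Pi.sub_apply, partialDeriv_testApprox h, add_sub_right_comm]
  rfl

end Density

/-! ### The Sobolev inequality -/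

section Sobolev

theorem eLpNorm_le_of_ae_tendsto {α F : Type*} [MeasurableSpace α] {μ : Measure α}
    [NormedAddCommGroup F] {p : ℝ≥0∞}
    {u : ℕ → α → F} {f : α → F} {b : ℕ → ℝ≥0∞} {B : ℝ≥0∞}
    (hu : ∀ n, AEStronglyMeasurable (u n) μ)
    (hlim : ∀ᵐ x ∂μ, Tendsto (fun n => u n x) atTop (𝓝 (f x)))
    (hle : ∀ n, eLpNorm (u n) p μ ≤ b n) (hb : Tendsto b atTop (𝓝 B)) : eLpNorm f p μ ≤ B :=
  calc eLpNorm f p μ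
      ≤ liminf (fun n => eLpNorm (u n) p μ) atTop := Lp.eLpNorm_lim_le_liminf_eLpNorm hu f hlim
    _ ≤ liminf b atTop := liminf_le_liminf (Eventually.of_forall hle)
    _ = B := hb.liminf_eq

variable {F : Type*} [NormedAddCommGroup F] [NormedSpace ℝ F] {k : Fin 3}

theorem MemH1.hasWeakPartial {f : R3 → F} (hf : MemH1 f) (k : Fin 3) :
    HasWeakPartial k f (weakPartial k f) :=
  (hf.memLp_deriv k).choose_spec.1.weakPartial

theorem MemH1.memLp_weakPartial [CompleteSpace F] {f : R3 → F} (hf : MemH1 f) (k : Fin 3) :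
    MemLp (weakPartial k f) 2 :=
  let ⟨_, hg, hg2⟩ := hf.memLp_deriv k
  hg2.ae_eq (weakPartial_ae_eq hg).symm

theorem MemD1.hasWeakPartial {f : R3 → F} (hf : MemD1 f) (k : Fin 3) :
    HasWeakPartial k f (weakPartial k f) :=
  (hf.memLp_deriv k).choose_spec.1.weakPartial

theorem MemD1.memLp_weakPartial [CompleteSpace F] {f : R3 → F} (hf : MemD1 f) (k : Fin 3) :
    MemLp (weakPartial k f) 2 :=
  let ⟨_, hg, hg2⟩ := hf.memLp_deriv k
  hg2.ae_eq (weakPartial_ae_eq hg).symm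

theorem norm_fderiv_le_sum_norm_partialDeriv (f : R3 → F) (x : R3) :
    ‖fderiv ℝ f x‖ ≤ ∑ k, ‖partialDeriv k f x‖ := by
  refine ContinuousLinearMap.opNorm_le_bound _ (by positivity) fun v => ?_
  have hv : v = ∑ k, v k • EuclideanSpace.single k (1 : ℝ) := by
    simpa using ((EuclideanSpace.basisFun (Fin 3) ℝ).sum_repr v).symm
  calc ‖fderiv ℝ f x v‖
      = ‖∑ k, v k • partialDeriv k f x‖ := by
        conv_lhs => rw [hv]
        simp only [map_sum, map_smul, partialDeriv]
    _ ≤ ∑ k, ‖v‖ * ‖partialDeriv k f x‖ := by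
        refine norm_sum_le_of_le _ fun k _ => ?_
        rw [norm_smul]
        gcongr
        exact PiLp.norm_apply_le v k
    _ = (∑ k, ‖partialDeriv k f x‖) * ‖v‖ := by rw [← Finset.mul_sum, mul_comm]

theorem eLpNorm_fderiv_le_sum {f : R3 → F} (hf : ContDiff ℝ 1 f) :
    eLpNorm (fderiv ℝ f) 2 volume ≤ ∑ k : Fin 3, eLpNorm (partialDeriv k f) 2 volume := by
  have hpointwise : eLpNorm (fderiv ℝ f) 2 volume ≤
      eLpNorm (fun x => ∑ k, ‖partialDeriv k f x‖) 2 volume :=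
    eLpNorm_mono_real (norm_fderiv_le_sum_norm_partialDeriv f)
  have hminkowski := eLpNorm_sum_le (μ := volume) (s := .univ)
    (f := fun k x => ‖partialDeriv k f x‖)
    (fun k _ => (continuous_partialDeriv hf).norm.aestronglyMeasurable) one_le_two
  simp only [eLpNorm_norm, Finset.sum_fn] at hminkowski
  exact hpointwise.trans hminkowski

theorem ae_tendsto_testApprox [CompleteSpace F] {f : R3 → F} (hf : LocallyIntegrable f) :
    ∀ᵐ x, Tendsto (fun n => testApprox f n x) atTop (𝓝 (f x)) := by
  filter_upwards [ae_tendsto_mollify hf] with x hx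
  simpa [testApprox] using (tendsto_cutoff x).smul hx

variable [FiniteDimensional ℝ F]

theorem exists_eLpNorm_six_le_of_memH1 (F : Type*) [NormedAddCommGroup F] [NormedSpace ℝ F]
    [FiniteDimensional ℝ F] :
    ∃ C : ℝ≥0, ∀ f : R3 → F, MemH1 f →
      eLpNorm f 6 volume ≤ C * ∑ k : Fin 3, eLpNorm (weakPartial k f) 2 volume := by
  have := FiniteDimensional.complete ℝ F
  refine ⟨SNormLESNormFDerivOfEqConst F (volume : Measure R3) (2 : ℝ≥0), fun f hf => ?_⟩
  set C := SNormLESNormFDerivOfEqConst F (volume : Measure R3) (2 : ℝ≥0)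
  have hloc : LocallyIntegrable f := hf.memLp.locallyIntegrable one_le_two
  have hsmooth := contDiff_testApprox hloc
  have hsobolev (n : ℕ) : eLpNorm (testApprox f n) 6 volume ≤
      C * ∑ k, (eLpNorm (partialDeriv k (testApprox f n) - weakPartial k f) 2 volume +
        eLpNorm (weakPartial k f) 2 volume) := by
    refine (eLpNorm_le_eLpNorm_fderiv_of_eq (p := 2) (p' := 6) volume
      ((hsmooth n).of_le (by simp)) (hasCompactSupport_testApprox f n) one_le_two (by simp)
      (by norm_num)).trans ?_
    gcongr
    refine (eLpNorm_fderiv_le_sum ((hsmooth n).of_le (by simp))).trans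
      (Finset.sum_le_sum fun k _ => ?_)
    have hpartial := (continuous_partialDeriv (k := k)
      ((hsmooth n).of_le (by simp))).aestronglyMeasurable (μ := volume)
    simpa using eLpNorm_add_le (hpartial.sub (hf.memLp_weakPartial k).1)
      (hf.memLp_weakPartial k).1 one_le_two
  refine eLpNorm_le_of_ae_tendsto (fun n => (hsmooth n).continuous.aestronglyMeasurable)
    (ae_tendsto_testApprox hloc) hsobolev
    (ENNReal.Tendsto.const_mul (tendsto_finsetSum _ fun k _ => ?_) (Or.inr ENNReal.coe_ne_top))
  simpa using (tendsto_eLpNorm_partialDeriv_testApprox_sub ENNReal.ofNat_ne_top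
    (hf.hasWeakPartial k) hf.memLp (hf.memLp_weakPartial k)).add_const
      (eLpNorm (weakPartial k f) 2 volume)

/-- The radial truncation at scale `r`: the identity on the ball of radius `r`, zero outside
the ball of radius `2 r`. -/
def truncate (r : ℝ) (s : F) : F := cutoff r s • s

theorem contDiff_truncate (r : ℝ) : ContDiff ℝ ∞ (truncate r : F → F) :=
  (contDiff_cutoff r).smul contDiff_id

theorem truncate_eq_self {r : ℝ} (hr : 0 < r) {s : F} (hs : ‖s‖ ≤ r) : truncate r s = s := by
  rw [truncate, cutoff_eq_one hr hs, one_smul]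

theorem norm_truncate_le {r : ℝ} (hr : 0 < r) (s : F) : ‖truncate r s‖ ≤ 2 * r := by
  rcases le_total ‖s‖ (2 * r) with hs | hs
  · rw [truncate, norm_smul]
    exact (mul_le_of_le_one_left (norm_nonneg s) (norm_cutoff_le_one r s)).trans hs
  · rw [truncate, cutoff_eq_zero hr hs, zero_smul, norm_zero]
    positivity

theorem exists_norm_fderiv_truncate_le (F : Type*) [NormedAddCommGroup F] [NormedSpace ℝ F]
    [FiniteDimensional ℝ F] :
    ∃ C : ℝ≥0, ∀ r : ℝ, 0 < r → ∀ s : F, ‖fderiv ℝ (truncate r) s‖ ≤ C := by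
  obtain ⟨C, hC⟩ := exists_norm_fderiv_cutoff_le F
  refine ⟨1 + 2 * C, fun r hr s => ?_⟩
  have hderiv : fderiv ℝ (truncate r) s =
      cutoff r s • ContinuousLinearMap.id ℝ F + (fderiv ℝ (cutoff r) s).smulRight s := by
    have hcutoff := (contDiff_cutoff r : ContDiff ℝ ∞ (cutoff r : F → ℝ)).differentiable (by simp) s
    have hmul : fderiv ℝ (truncate r) s = _ := fderiv_fun_smul hcutoff differentiableAt_id
    simpa using hmul
  have hcross : ‖(fderiv ℝ (cutoff r) s).smulRight s‖ ≤ 2 * C := by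
    rw [ContinuousLinearMap.norm_smulRight_apply]
    rcases le_or_gt ‖s‖ (2 * r) with hs | hs
    · calc ‖fderiv ℝ (cutoff r) s‖ * ‖s‖ ≤ C / r * (2 * r) := by gcongr; exact hC r hr s
        _ = 2 * C := by field_simp
    · have hzero : cutoff r =ᶠ[𝓝 s] fun _ => 0 := by
        filter_upwards [continuous_norm.continuousAt.eventually (lt_mem_nhds hs)] with z hz
        exact cutoff_eq_zero hr hz.le
      rw [hzero.fderiv_eq]
      simp
  calc ‖fderiv ℝ (truncate r) s‖
      ≤ ‖cutoff r s • ContinuousLinearMap.id ℝ F‖ + ‖(fderiv ℝ (cutoff r) s).smulRight s‖ := by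
        rw [hderiv]
        exact norm_add_le _ _
    _ ≤ 1 + 2 * C := by
        gcongr
        rw [norm_smul]
        exact mul_le_one₀ (norm_cutoff_le_one r s) (norm_nonneg _) ContinuousLinearMap.norm_id_le

/-- Removes both the small and the large values of its argument, at scales `1 / (n + 1)` and
`n + 1`. It carries functions of `D¹` to functions of `H¹`. -/
def bandTruncate (n : ℕ) (s : F) : F := truncate (n + 1) s - truncate (n + 1 : ℝ)⁻¹ s

theorem contDiff_bandTruncate (n : ℕ) : ContDiff ℝ ∞ (bandTruncate n : F → F) :=
  (contDiff_truncate _).sub (contDiff_truncate _)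

theorem exists_norm_fderiv_bandTruncate_le (F : Type*) [NormedAddCommGroup F] [NormedSpace ℝ F]
    [FiniteDimensional ℝ F] :
    ∃ C : ℝ≥0, ∀ (n : ℕ) (s : F), ‖fderiv ℝ (bandTruncate n) s‖ ≤ C := by
  obtain ⟨C, hC⟩ := exists_norm_fderiv_truncate_le F
  refine ⟨C + C, fun n s => ?_⟩
  have hdiff (r : ℝ) : DifferentiableAt ℝ (truncate r) s :=
    (contDiff_truncate r).differentiable (by simp) s
  have hderiv : fderiv ℝ (bandTruncate n) s = _ := fderiv_fun_sub (hdiff _) (hdiff _)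
  rw [hderiv]
  exact (norm_sub_le _ _).trans
    (add_le_add (hC _ (by positivity) s) (hC _ (by positivity) s))

theorem norm_bandTruncate_le (n : ℕ) (s : F) :
    ‖bandTruncate n s‖ ≤ 2 * (n + 1) + 2 * (n + 1 : ℝ)⁻¹ :=
  (norm_sub_le _ _).trans
    (add_le_add (norm_truncate_le (by positivity) s) (norm_truncate_le (by positivity) s))

theorem bandTruncate_eq_zero {n : ℕ} {s : F} (hs : ‖s‖ ≤ (n + 1 : ℝ)⁻¹) :
    bandTruncate n s = 0 := by
  have hle : (n + 1 : ℝ)⁻¹ ≤ n + 1 :=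
    (inv_le_one_of_one_le₀ (by simp)).trans (by simp)
  rw [bandTruncate, truncate_eq_self (by positivity) (hs.trans hle),
    truncate_eq_self (by positivity) hs, sub_self]

theorem tendsto_bandTruncate (s : F) : Tendsto (fun n => bandTruncate n s) atTop (𝓝 s) := by
  have hlarge : Tendsto (fun n : ℕ => truncate (n + 1 : ℝ) s) atTop (𝓝 s) := by
    simpa [truncate] using (tendsto_cutoff s).smul_const s
  have hsmall : Tendsto (fun n : ℕ => truncate (n + 1 : ℝ)⁻¹ s) atTop (𝓝 0) := by
    refine squeeze_zero_norm (fun n => norm_truncate_le (by positivity) s) ?_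
    simpa using (tendsto_one_div_add_atTop_nhds_zero_nat (𝕜 := ℝ)).const_mul 2
  simpa [bandTruncate] using hlarge.sub hsmall

theorem MemD1.memLp_bandTruncate {f : R3 → F} (hf : MemD1 f) (n : ℕ) :
    MemLp (fun x => bandTruncate n (f x)) 2 := by
  have hmeas := (contDiff_bandTruncate n).continuous.comp_aestronglyMeasurable
    hf.locallyIntegrable.aestronglyMeasurable
  refine (memLp_top_of_bound hmeas _ (ae_of_all _ fun x => norm_bandTruncate_le n (f x)))
    |>.mono_exponent_of_measure_support_ne_top (fun x hx => bandTruncate_eq_zero (not_lt.1 hx))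
      (hf.vanish _ (by positivity)).ne le_top

theorem MemD1.memH1_bandTruncate {f : R3 → F} (hf : MemD1 f) (n : ℕ) :
    MemH1 fun x => bandTruncate n (f x) where
  memLp := hf.memLp_bandTruncate n
  memLp_deriv k := by
    have := FiniteDimensional.complete ℝ F
    obtain ⟨C, hC⟩ := exists_norm_fderiv_bandTruncate_le F
    have hpartial := (hf.hasWeakPartial k).comp_contDiff
      ((contDiff_bandTruncate n).of_le (by simp)) (hC n)
    exact ⟨_, hpartial, (hf.memLp_weakPartial k).of_le_mul
      hpartial.locallyIntegrable_deriv.aestronglyMeasurable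
      (ae_of_all _ fun x => ContinuousLinearMap.le_of_opNorm_le _ (hC n (f x)) _)⟩

theorem exists_eLpNorm_six_le_of_memD1 (F : Type*) [NormedAddCommGroup F] [NormedSpace ℝ F]
    [FiniteDimensional ℝ F] :
    ∃ C : ℝ≥0, ∀ f : R3 → F, MemD1 f →
      eLpNorm f 6 volume ≤ C * ∑ k : Fin 3, eLpNorm (weakPartial k f) 2 volume := by
  have := FiniteDimensional.complete ℝ F
  obtain ⟨C, hC⟩ := exists_eLpNorm_six_le_of_memH1 F
  obtain ⟨D, hD⟩ := exists_norm_fderiv_bandTruncate_le F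
  refine ⟨C * D, fun f hf => ?_⟩
  have hpartial_le (n : ℕ) (k : Fin 3) :
      eLpNorm (weakPartial k fun x => bandTruncate n (f x)) 2 volume ≤
        D * eLpNorm (weakPartial k f) 2 volume := by
    have hpartial := (hf.hasWeakPartial k).comp_contDiff
      ((contDiff_bandTruncate n).of_le (by simp)) (hD n)
    rw [eLpNorm_congr_ae (weakPartial_ae_eq hpartial)]
    exact eLpNorm_le_nnreal_smul_eLpNorm_of_ae_le_mul
      (ae_of_all _ fun x => ContinuousLinearMap.le_of_opNorm_le _ (hD n (f x)) _) 2
  refine eLpNorm_le_of_ae_tendsto (fun n => (hf.memLp_bandTruncate n).1)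
    (ae_of_all _ fun x => tendsto_bandTruncate (f x)) (fun n => ?_) tendsto_const_nhds
  calc eLpNorm (fun x => bandTruncate n (f x)) 6 volume
      ≤ C * ∑ k : Fin 3, eLpNorm (weakPartial k fun x => bandTruncate n (f x)) 2 volume :=
        hC _ (hf.memH1_bandTruncate n)
    _ ≤ C * ∑ k : Fin 3, D * eLpNorm (weakPartial k f) 2 volume := by
        gcongr with k
        exact hpartial_le n k
    _ = (C * D : ℝ≥0) * ∑ k : Fin 3, eLpNorm (weakPartial k f) 2 volume := by
        rw [← Finset.mul_sum, ENNReal.coe_mul, mul_assoc]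

end Sobolev

/-! ### Hölder estimates -/

section Hoelder

instance holderTriple_six_three_two : ENNReal.HolderTriple 6 3 2 where
  inv_add_inv_eq_inv := by
    rw [← ENNReal.toReal_eq_toReal_iff' (by simp) (by simp), ENNReal.toReal_add (by simp) (by simp)]
    norm_num

instance holderTriple_four_four_two : ENNReal.HolderTriple 4 4 2 where
  inv_add_inv_eq_inv := by
    rw [← ENNReal.toReal_eq_toReal_iff' (by simp) (by simp), ENNReal.toReal_add (by simp) (by simp)]
    norm_num

instance holderTriple_two_six : ENNReal.HolderTriple 2 6 (3 / 2) where
  inv_add_inv_eq_inv := by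
    rw [← ENNReal.toReal_eq_toReal_iff' (by simp) (by simp), ENNReal.toReal_add (by simp) (by simp)]
    norm_num

variable {α E F G : Type*} [MeasurableSpace α] {μ : Measure α} [NormedAddCommGroup E]
  [NormedAddCommGroup F] [NormedAddCommGroup G] {p q r s : ℝ≥0∞}

theorem eLpNorm_sq_le_mul [ENNReal.HolderTriple p q r] {f : α → F}
    (hf : AEStronglyMeasurable f μ) :
    eLpNorm f (r * 2) μ ^ 2 ≤ eLpNorm f p μ * eLpNorm f q μ := by
  have hsquare := eLpNorm_norm_rpow (p := r) (μ := μ) f two_pos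
  have hhoelder := eLpNorm_smul_le_mul_eLpNorm (p := p) (q := q) (r := r) hf.norm hf.norm
  simp only [eLpNorm_norm] at hhoelder
  calc eLpNorm f (r * 2) μ ^ 2
      = eLpNorm (fun x => ‖f x‖ ^ (2 : ℝ)) r μ := by
        rw [hsquare, ENNReal.ofReal_ofNat, ENNReal.rpow_two]
    _ = eLpNorm ((fun x => ‖f x‖) • fun x => ‖f x‖) r μ := by
        congr 1
        funext x
        simp [sq]
    _ ≤ _ := hhoelder

theorem memLp_mul_two [ENNReal.HolderTriple p q r] {f : α → F} (hp : MemLp f p μ)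
    (hq : MemLp f q μ) : MemLp f (r * 2) μ := by
  refine ⟨hp.1, lt_top_iff_ne_top.2 fun htop => ?_⟩
  have hle := eLpNorm_sq_le_mul (p := p) (q := q) (r := r) hp.1
  rw [htop, ENNReal.top_pow two_ne_zero, top_le_iff] at hle
  exact ENNReal.mul_ne_top hp.2.ne hq.2.ne hle

theorem lpNorm_sq_le_mul [ENNReal.HolderTriple p q r] {f : α → F} (hp : MemLp f p μ)
    (hq : MemLp f q μ) : lpNorm f (r * 2) μ ^ 2 ≤ lpNorm f p μ * lpNorm f q μ := by
  simp only [← toReal_eLpNorm hp.1]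
  rw [← ENNReal.toReal_pow, ← ENNReal.toReal_mul]
  exact ENNReal.toReal_mono (ENNReal.mul_ne_top hp.2.ne hq.2.ne) (eLpNorm_sq_le_mul hp.1)

theorem lpNorm_mul_le [ENNReal.HolderTriple p q r] {f g : α → ℝ} (hf : MemLp f p μ)
    (hg : MemLp g q μ) : lpNorm (f * g) r μ ≤ lpNorm f p μ * lpNorm g q μ := by
  have hle : eLpNorm (f • g) r μ ≤ eLpNorm f p μ * eLpNorm g q μ :=
    eLpNorm_smul_le_mul_eLpNorm hg.1 hf.1
  rw [smul_eq_mul] at hle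
  rw [← toReal_eLpNorm (hf.1.mul hg.1), ← toReal_eLpNorm hf.1, ← toReal_eLpNorm hg.1,
    ← ENNReal.toReal_mul]
  exact ENNReal.toReal_mono (ENNReal.mul_ne_top hf.2.ne hg.2.ne) hle

theorem integral_norm_mul_norm_mul_norm_le [ENNReal.HolderTriple p q s]
    [ENNReal.HolderTriple s r 1] {f : α → E} {g : α → F} {h : α → G} (hf : MemLp f p μ)
    (hg : MemLp g q μ) (hh : MemLp h r μ) :
    ∫ x, ‖f x‖ * ‖g x‖ * ‖h x‖ ∂μ ≤ lpNorm f p μ * lpNorm g q μ * lpNorm h r μ := by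
  have hfg : MemLp (fun x => ‖f x‖ * ‖g x‖) s μ := hg.norm.mul hf.norm
  calc ∫ x, ‖f x‖ * ‖g x‖ * ‖h x‖ ∂μ
      = lpNorm (fun x => ‖f x‖ * ‖g x‖ * ‖h x‖) 1 μ := by
        have hfgh : AEStronglyMeasurable (fun x => ‖f x‖ * ‖g x‖ * ‖h x‖) μ := hfg.1.mul hh.norm.1
        simp [lpNorm_one_eq_integral_norm hfgh]
    _ ≤ lpNorm (fun x => ‖f x‖ * ‖g x‖) s μ * lpNorm (fun x => ‖h x‖) r μ :=
        lpNorm_mul_le hfg hh.norm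
    _ ≤ lpNorm (fun x => ‖f x‖) p μ * lpNorm (fun x => ‖g x‖) q μ * lpNorm (fun x => ‖h x‖) r μ :=
        mul_le_mul_of_nonneg_right (lpNorm_mul_le hf.norm hg.norm) lpNorm_nonneg
    _ = lpNorm f p μ * lpNorm g q μ * lpNorm h r μ := by
        rw [lpNorm_norm hf.1, lpNorm_norm hg.1, lpNorm_norm hh.1]

theorem memLp_three {f : α → F} (h2 : MemLp f 2 μ) (h6 : MemLp f 6 μ) : MemLp f 3 μ := by
  have := memLp_mul_two (r := 3 / 2) h2 h6
  rwa [ENNReal.div_mul_cancel (by simp) (by simp)] at this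

theorem memLp_four {f : α → F} (h2 : MemLp f 2 μ) (h6 : MemLp f 6 μ) : MemLp f 4 μ := by
  have := memLp_mul_two (r := 2) h6 (memLp_three h2 h6)
  norm_num at this
  exact this

theorem lpNorm_three_sq_le {f : α → F} (h2 : MemLp f 2 μ) (h6 : MemLp f 6 μ) :
    lpNorm f 3 μ ^ 2 ≤ lpNorm f 2 μ * lpNorm f 6 μ := by
  have := lpNorm_sq_le_mul (r := 3 / 2) h2 h6
  rwa [ENNReal.div_mul_cancel (by simp) (by simp)] at this

theorem eLpNorm_bilin_le [NormedSpace ℝ E] [NormedSpace ℝ F] [NormedSpace ℝ G]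
    [ENNReal.HolderTriple p q r] (B : E →L[ℝ] F →L[ℝ] G) {f : α → E} {g : α → F}
    (hf : AEStronglyMeasurable f μ) (hg : AEStronglyMeasurable g μ) :
    eLpNorm (fun x => B (f x) (g x)) r μ ≤ ‖B‖₊ * eLpNorm f p μ * eLpNorm g q μ :=
  eLpNorm_le_eLpNorm_mul_eLpNorm_of_nnnorm hf hg (B · ·) ‖B‖₊
    (ae_of_all _ fun x => B.le_opNorm₂ (f x) (g x))

theorem eLpNorm_bilin_sub_le [NormedSpace ℝ E] [NormedSpace ℝ F] [NormedSpace ℝ G]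
    [ENNReal.HolderTriple p q r] (hr : 1 ≤ r) (B : E →L[ℝ] F →L[ℝ] G) {u f : α → E} {w g : α → F}
    (hu : MemLp u p μ) (hf : MemLp f p μ) (hw : MemLp w q μ) (hg : MemLp g q μ) :
    eLpNorm ((fun x => B (u x) (w x)) - fun x => B (f x) (g x)) r μ ≤
      ‖B‖₊ * (eLpNorm (u - f) p μ * eLpNorm (w - g) q μ + eLpNorm (u - f) p μ * eLpNorm g q μ +
        eLpNorm f p μ * eLpNorm (w - g) q μ) := by
  have hdu := (hu.sub hf).1
  have hdw := (hw.sub hg).1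
  have hmeas {a : α → E} {b : α → F} (ha : AEStronglyMeasurable a μ)
      (hb : AEStronglyMeasurable b μ) := B.aestronglyMeasurable_comp₂ ha hb
  calc eLpNorm ((fun x => B (u x) (w x)) - fun x => B (f x) (g x)) r μ
      = eLpNorm ((fun x => B ((u - f) x) ((w - g) x)) + (fun x => B ((u - f) x) (g x)) +
          fun x => B (f x) ((w - g) x)) r μ := by
        congr 1
        funext x
        simp only [Pi.sub_apply, Pi.add_apply, map_sub, sub_apply]
        abel
    _ ≤ eLpNorm (fun x => B ((u - f) x) ((w - g) x)) r μ +
          eLpNorm (fun x => B ((u - f) x) (g x)) r μ +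
          eLpNorm (fun x => B (f x) ((w - g) x)) r μ := by
        refine (eLpNorm_add_le ((hmeas hdu hdw).add (hmeas hdu hg.1)) (hmeas hf.1 hdw) hr).trans ?_
        gcongr
        exact eLpNorm_add_le (hmeas hdu hdw) (hmeas hdu hg.1) hr
    _ ≤ ‖B‖₊ * (eLpNorm (u - f) p μ * eLpNorm (w - g) q μ + eLpNorm (u - f) p μ * eLpNorm g q μ +
          eLpNorm f p μ * eLpNorm (w - g) q μ) := by
        simp only [mul_add, ← mul_assoc]
        gcongr
        · exact eLpNorm_bilin_le B hdu hdw
        · exact eLpNorm_bilin_le B hdu hg.1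
        · exact eLpNorm_bilin_le B hf.1 hdw

/-- Convergence in `Lᵖ`, bundled with membership of the sequence and of its limit. -/
structure TendstoInLp (p : ℝ≥0∞) (μ : Measure α) (u : ℕ → α → E) (f : α → E) : Prop where
  memLp : ∀ n, MemLp (u n) p μ
  memLp_limit : MemLp f p μ
  tendsto : Tendsto (fun n => eLpNorm (u n - f) p μ) atTop (𝓝 0)

namespace TendstoInLp

variable {u : ℕ → α → E} {f : α → E}

theorem const (hf : MemLp f p μ) : TendstoInLp p μ (fun _ => f) f :=
  ⟨fun _ => hf, hf, by simp⟩

theorem add [Fact (1 ≤ p)] {w : ℕ → α → E} {g : α → E} (hu : TendstoInLp p μ u f)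
    (hw : TendstoInLp p μ w g) :
    TendstoInLp p μ (fun n x => u n x + w n x) fun x => f x + g x where
  memLp n := (hu.memLp n).add (hw.memLp n)
  memLp_limit := hu.memLp_limit.add hw.memLp_limit
  tendsto := by
    have hsum := hu.tendsto.add hw.tendsto
    rw [add_zero] at hsum
    refine tendsto_of_tendsto_of_tendsto_of_le_of_le tendsto_const_nhds hsum
      (fun _ => zero_le) fun n => ?_
    calc eLpNorm ((fun x => u n x + w n x) - fun x => f x + g x) p μ
        = eLpNorm ((u n - f) + (w n - g)) p μ := congrArg (eLpNorm · p μ)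
          (add_sub_add_comm (u n) (w n) f g)
      _ ≤ eLpNorm (u n - f) p μ + eLpNorm (w n - g) p μ :=
        eLpNorm_add_le ((hu.memLp n).sub hu.memLp_limit).1 ((hw.memLp n).sub hw.memLp_limit).1
          Fact.out

theorem tendsto_integral [NormedSpace ℝ E] (hu : TendstoInLp 1 μ u f) :
    Tendsto (fun n => ∫ x, u n x ∂μ) atTop (𝓝 (∫ x, f x ∂μ)) :=
  tendsto_integral_of_L1' f hu.memLp_limit.1
    (Eventually.of_forall fun n => memLp_one_iff_integrable.1 (hu.memLp n)) hu.tendsto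

variable [NormedSpace ℝ E] [NormedSpace ℝ F] [NormedSpace ℝ G]

theorem bilin [ENNReal.HolderTriple p q r] [Fact (1 ≤ r)] (B : E →L[ℝ] F →L[ℝ] G)
    {w : ℕ → α → F} {g : α → F} (hu : TendstoInLp p μ u f) (hw : TendstoInLp q μ w g) :
    TendstoInLp r μ (fun n x => B (u n x) (w n x)) fun x => B (f x) (g x) where
  memLp n := B.memLp_of_bilin r (hu.memLp n) (hw.memLp n)
  memLp_limit := B.memLp_of_bilin r hu.memLp_limit hw.memLp_limit
  tendsto := by
    have hvanish {a b : ℕ → ℝ≥0∞} {s t : ℝ≥0∞} (ha : Tendsto a atTop (𝓝 s))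
        (hb : Tendsto b atTop (𝓝 t)) (hs : s ≠ ⊤) (ht : t ≠ ⊤) (hst : s * t = 0) :
        Tendsto (fun n => a n * b n) atTop (𝓝 0) :=
      hst ▸ ENNReal.Tendsto.mul ha (.inr ht) hb (.inr hs)
    have hmajorant := ((hvanish hu.tendsto hw.tendsto (by simp) (by simp) (by simp)).add
      (hvanish hu.tendsto (tendsto_const_nhds (x := eLpNorm g q μ)) (by simp)
        hw.memLp_limit.2.ne (by simp))).add
      (hvanish (tendsto_const_nhds (x := eLpNorm f p μ)) hw.tendsto hu.memLp_limit.2.ne (by simp)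
        (by simp))
    simp only [add_zero] at hmajorant
    exact tendsto_zero_of_le_const_mul (ENNReal.coe_ne_top (r := ‖B‖₊)) hmajorant fun n =>
      eLpNorm_bilin_sub_le Fact.out B (hu.memLp n) hu.memLp_limit (hw.memLp n) hw.memLp_limit

theorem clm (hu : TendstoInLp p μ u f) (L : E →L[ℝ] F) :
    TendstoInLp p μ (fun n x => L (u n x)) fun x => L (f x) where
  memLp n := L.comp_memLp' (hu.memLp n)
  memLp_limit := L.comp_memLp' hu.memLp_limit
  tendsto := by
    refine tendsto_zero_of_le_const_mul (ENNReal.coe_ne_top (r := ‖L‖₊)) hu.tendsto fun n => ?_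
    refine eLpNorm_le_nnreal_smul_eLpNorm_of_ae_le_mul (ae_of_all _ fun x => ?_) p
    simpa [← map_sub] using L.le_opNNNorm (u n x - f x)

end TendstoInLp

theorem normSqL2_nonneg {H : Type*} [NormedAddCommGroup H] (f : R3 → H) :
    0 ≤ normSqL2 f :=
  integral_nonneg fun _ => by positivity

theorem normSqL2_eq_lpNorm_sq {H : Type*} [NormedAddCommGroup H] {f : R3 → H}
    (hf : AEStronglyMeasurable f volume) : normSqL2 f = lpNorm f 2 volume ^ 2 := by
  rw [lpNorm_eq_integral_norm_rpow_toReal (by simp) (by simp) hf, ENNReal.toReal_ofNat,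
    ← Real.rpow_natCast, ← Real.rpow_mul (integral_nonneg fun _ => by positivity)]
  simp [normSqL2]

end Hoelder

/-! ### The diamagnetic inequality -/

section Diamagnetic

open RealInnerProductSpace

variable {H : Type*} [NormedAddCommGroup H]

/-- A smooth approximation of the norm, which it approaches from below as `ε → 0`. -/
def smoothNorm (ε : ℝ) (z : H) : ℝ := √(‖z‖ ^ 2 + ε ^ 2) - ε

theorem norm_le_sqrt_norm_sq_add (ε : ℝ) (z : H) : ‖z‖ ≤ √(‖z‖ ^ 2 + ε ^ 2) :=
  Real.le_sqrt_of_sq_le (by nlinarith [sq_nonneg ε])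

theorem smoothNorm_nonneg {ε : ℝ} (z : H) : 0 ≤ smoothNorm ε z :=
  sub_nonneg.2 (Real.le_sqrt_of_sq_le (by nlinarith [sq_nonneg ‖z‖]))

theorem smoothNorm_le {ε : ℝ} (hε : 0 ≤ ε) (z : H) : smoothNorm ε z ≤ ‖z‖ := by
  rw [smoothNorm, sub_le_iff_le_add, Real.sqrt_le_left (by positivity)]
  nlinarith [mul_nonneg hε (norm_nonneg z)]

theorem tendsto_smoothNorm (z : H) {ε : ℕ → ℝ} (hε : Tendsto ε atTop (𝓝 0)) :
    Tendsto (fun n => smoothNorm (ε n) z) atTop (𝓝 ‖z‖) := by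
  have hcont : Continuous fun t : ℝ => smoothNorm t z := by
    unfold smoothNorm
    fun_prop
  have hlim := (hcont.tendsto 0).comp hε
  rwa [show smoothNorm 0 z = ‖z‖ by simp [smoothNorm]] at hlim

variable [InnerProductSpace ℝ H]

theorem contDiff_smoothNorm {n : WithTop ℕ∞} {ε : ℝ} (hε : 0 < ε) :
    ContDiff ℝ n (smoothNorm ε : H → ℝ) :=
  (((contDiff_norm_sq ℝ).add contDiff_const).sqrt fun z => by positivity).sub contDiff_const

theorem fderiv_smoothNorm {ε : ℝ} (hε : 0 < ε) (z w : H) :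
    fderiv ℝ (smoothNorm ε) z w = ⟪z, w⟫ / √(‖z‖ ^ 2 + ε ^ 2) := by
  have hsq := ((hasStrictFDerivAt_norm_sq z).hasFDerivAt.add_const (ε ^ 2)).sqrt
    (by positivity : ‖z‖ ^ 2 + ε ^ 2 ≠ 0)
  have hderiv : HasFDerivAt (smoothNorm ε) _ z := hsq.sub_const ε
  rw [hderiv.fderiv]
  simp only [one_div, mul_inv_rev, smul_apply, coe_innerSL_apply, nsmul_eq_mul, Nat.cast_ofNat,
    smul_eq_mul]
  field_simp

theorem norm_fderiv_smoothNorm_le {ε : ℝ} (hε : 0 < ε) (z : H) :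
    ‖fderiv ℝ (smoothNorm ε) z‖ ≤ 1 := by
  refine ContinuousLinearMap.opNorm_le_bound _ zero_le_one fun w => ?_
  rw [fderiv_smoothNorm hε, norm_div, one_mul, Real.norm_of_nonneg (Real.sqrt_nonneg _),
    div_le_iff₀ (by positivity), mul_comm]
  calc ‖⟪z, w⟫‖ ≤ ‖z‖ * ‖w‖ := norm_inner_le_norm z w
    _ ≤ _ := by gcongr; exact norm_le_sqrt_norm_sq_add ε z

theorem norm_fderiv_smoothNorm_apply_le {ε a : ℝ} (hε : 0 < ε) {z w : H}
    (h : |⟪z, w⟫| ≤ ‖z‖ * a) : ‖fderiv ℝ (smoothNorm ε) z w‖ ≤ ‖a‖ := by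
  rw [fderiv_smoothNorm hε, norm_div, Real.norm_of_nonneg (Real.sqrt_nonneg _),
    div_le_iff₀ (by positivity), mul_comm]
  calc ‖⟪z, w⟫‖ ≤ ‖z‖ * a := h
    _ ≤ ‖z‖ * ‖a‖ := by gcongr; exact le_abs_self a
    _ ≤ √(‖z‖ ^ 2 + ε ^ 2) * ‖a‖ := by gcongr; exact norm_le_sqrt_norm_sq_add ε z

variable [CompleteSpace H]

theorem MemH1.hasWeakPartial_smoothNorm {ψ : R3 → H} (hψ : MemH1 ψ) {ε : ℝ} (hε : 0 < ε)
    (k : Fin 3) :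
    HasWeakPartial k (fun x => smoothNorm ε (ψ x))
      fun x => fderiv ℝ (smoothNorm ε) (ψ x) (weakPartial k ψ x) :=
  (hψ.hasWeakPartial k).comp_contDiff (contDiff_smoothNorm hε) (C := 1)
    (norm_fderiv_smoothNorm_le hε)

theorem MemH1.smoothNorm {ψ : R3 → H} (hψ : MemH1 ψ) {ε : ℝ} (hε : 0 < ε) :
    MemH1 fun x => smoothNorm ε (ψ x) where
  memLp := hψ.memLp.of_le
    ((contDiff_smoothNorm (n := 0) hε).continuous.comp_aestronglyMeasurable hψ.memLp.1)
    (ae_of_all _ fun x => by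
      rw [Real.norm_of_nonneg (smoothNorm_nonneg _)]
      exact smoothNorm_le hε.le _)
  memLp_deriv k := by
    have hpartial := hψ.hasWeakPartial_smoothNorm hε k
    refine ⟨_, hpartial, (hψ.memLp_weakPartial k).of_le
      hpartial.locallyIntegrable_deriv.aestronglyMeasurable (ae_of_all _ fun x => ?_)⟩
    simpa using ContinuousLinearMap.le_of_opNorm_le _ (norm_fderiv_smoothNorm_le hε (ψ x)) _

variable (H) in
theorem exists_eLpNorm_six_le_of_abs_inner_le :
    ∃ C : ℝ≥0, ∀ (ψ : R3 → H) (h : Fin 3 → R3 → ℝ), MemH1 ψ →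
      (∀ k, ∀ᵐ x, |⟪ψ x, weakPartial k ψ x⟫| ≤ ‖ψ x‖ * h k x) →
      eLpNorm ψ 6 volume ≤ C * ∑ k : Fin 3, eLpNorm (h k) 2 volume := by
  obtain ⟨C, hC⟩ := exists_eLpNorm_six_le_of_memH1 ℝ
  refine ⟨C, fun ψ h hψ hinner => ?_⟩
  have hpos (n : ℕ) : (0 : ℝ) < 1 / (n + 1) := by positivity
  rw [← eLpNorm_norm ψ]
  refine eLpNorm_le_of_ae_tendsto (fun n => (hψ.smoothNorm (hpos n)).memLp.1)
    (ae_of_all _ fun x => tendsto_smoothNorm (ψ x) tendsto_one_div_add_atTop_nhds_zero_nat)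
    (fun n => (hC _ (hψ.smoothNorm (hpos n))).trans ?_) tendsto_const_nhds
  gcongr with k
  rw [eLpNorm_congr_ae (weakPartial_ae_eq (hψ.hasWeakPartial_smoothNorm (hpos n) k))]
  refine eLpNorm_mono_ae ?_
  filter_upwards [hinner k] with x hx using norm_fderiv_smoothNorm_apply_le (hpos n) hx

end Diamagnetic

section SobolevReal

variable {E F : Type*} [NormedAddCommGroup E] [NormedAddCommGroup F]

theorem eLpNorm_six_lt_top {C : ℝ≥0} {f : R3 → E}
    {h : Fin 3 → R3 → F} (hh : ∀ k, MemLp (h k) 2)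
    (hle : eLpNorm f 6 volume ≤ C * ∑ k : Fin 3, eLpNorm (h k) 2 volume) :
    eLpNorm f 6 volume < ⊤ :=
  hle.trans_lt (ENNReal.mul_lt_top (by simp) (ENNReal.sum_lt_top.2 fun k _ => (hh k).2))

theorem lpNorm_six_le_of_eLpNorm_le {C : ℝ≥0} {f : R3 → E}
    {h : Fin 3 → R3 → F} (hf : AEStronglyMeasurable f volume) (hh : ∀ k, MemLp (h k) 2)
    (hle : eLpNorm f 6 volume ≤ C * ∑ k : Fin 3, eLpNorm (h k) 2 volume) :
    lpNorm f 6 volume ≤ C * √3 * √(∑ k : Fin 3, normSqL2 (h k)) := by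
  have hsum : (∑ k : Fin 3, lpNorm (h k) 2 volume) ^ 2 ≤ 3 * ∑ k : Fin 3, normSqL2 (h k) := by
    simpa [normSqL2_eq_lpNorm_sq (hh _).1] using
      sq_sum_le_card_mul_sum_sq (s := Finset.univ) (f := fun k => lpNorm (h k) 2 volume)
  calc lpNorm f 6 volume
      ≤ C * ∑ k : Fin 3, lpNorm (h k) 2 volume := by
        simp only [← toReal_eLpNorm hf, ← toReal_eLpNorm (hh _).1]
        rw [← ENNReal.toReal_sum fun k _ => (hh k).2.ne, ← ENNReal.coe_toReal C,
          ← ENNReal.toReal_mul]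
        exact ENNReal.toReal_mono (ENNReal.mul_ne_top (by simp)
          (ENNReal.sum_ne_top.2 fun k _ => (hh k).2.ne)) hle
    _ ≤ C * √(3 * ∑ k : Fin 3, normSqL2 (h k)) := by
        gcongr
        exact Real.le_sqrt_of_sq_le hsum
    _ = C * √3 * √(∑ k : Fin 3, normSqL2 (h k)) := by
        rw [Real.sqrt_mul (by norm_num), mul_assoc]

variable [NormedSpace ℝ F]

/-- The squared `L²`-norm `‖∇ ⊗ A‖²` of the Jacobian. -/
def gradNormSq (f : R3 → F) : ℝ := ∑ k, normSqL2 (weakPartial k f)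

theorem gradNormSq_nonneg (f : R3 → F) : 0 ≤ gradNormSq f :=
  Finset.sum_nonneg fun _ _ => normSqL2_nonneg _

variable [FiniteDimensional ℝ F] {f : R3 → F}

theorem MemH1.memLp_six (hf : MemH1 f) : MemLp f 6 := by
  obtain ⟨C, hC⟩ := exists_eLpNorm_six_le_of_memH1 F
  exact ⟨hf.memLp.1, eLpNorm_six_lt_top hf.memLp_weakPartial (hC f hf)⟩

theorem MemD1.memLp_six (hf : MemD1 f) : MemLp f 6 := by
  obtain ⟨C, hC⟩ := exists_eLpNorm_six_le_of_memD1 F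
  exact ⟨hf.locallyIntegrable.aestronglyMeasurable,
    eLpNorm_six_lt_top hf.memLp_weakPartial (hC f hf)⟩

theorem MemH1.memLp_three (hf : MemH1 f) : MemLp f 3 :=
  TravellingWave.memLp_three hf.memLp hf.memLp_six

theorem MemH1.memLp_four (hf : MemH1 f) : MemLp f 4 :=
  TravellingWave.memLp_four hf.memLp hf.memLp_six

variable (F) in
theorem exists_lpNorm_six_le_of_memD1 :
    ∃ C : ℝ, 0 < C ∧ ∀ f : R3 → F, MemD1 f → lpNorm f 6 volume ≤ C * √(gradNormSq f) := by
  obtain ⟨C, hC⟩ := exists_eLpNorm_six_le_of_memD1 F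
  refine ⟨C * √3 + 1, by positivity, fun f hf => ?_⟩
  exact (lpNorm_six_le_of_eLpNorm_le hf.locallyIntegrable.aestronglyMeasurable
    hf.memLp_weakPartial (hC f hf)).trans
      (mul_le_mul_of_nonneg_right (lt_add_one _).le (Real.sqrt_nonneg _))

end SobolevReal

section Covariant

variable {ħ c Q : ℝ} {A : R3 → R3} {ψ : R3 → C2}

theorem covDeriv_add_const (ħ c Q : ℝ) (A : R3 → R3) (w : R3) (ψ : R3 → C2) (k : Fin 3) (x : R3) :
    covDeriv ħ c Q (fun y => A y + w) ψ k x =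
      covDeriv ħ c Q A ψ k x + (Q / c * w k) • ψ x := by
  simp only [covDeriv, PiLp.add_apply, mul_add, Complex.ofReal_add, add_smul, add_assoc]
  rfl

theorem inner_I_smul_I_smul (y z : C2) : inner ℝ (Complex.I • y) (Complex.I • z) = inner ℝ y z := by
  have hinner : inner ℂ (Complex.I • y) (Complex.I • z) = inner ℂ y z := by
    rw [inner_smul_left, inner_smul_right, ← mul_assoc]
    simp
  exact congrArg Complex.re hinner

theorem inner_I_smul_covDeriv (k : Fin 3) (x : R3) :
    inner ℝ (Complex.I • ψ x) (covDeriv ħ c Q A ψ k x) =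
      ħ * inner ℝ (ψ x) (weakPartial k ψ x) := by
  rw [covDeriv, mul_comm, mul_smul, Complex.coe_smul, Complex.coe_smul, inner_add_right,
    real_inner_smul_right, real_inner_smul_right, inner_I_smul_I_smul,
    real_inner_comm (ψ x) (Complex.I • ψ x), show inner ℝ (ψ x) (Complex.I • ψ x) = 0 from
      real_inner_I_smul_self (𝕜 := ℂ) (ψ x), mul_zero, add_zero]

theorem abs_inner_weakPartial_le (hħ : 0 < ħ) (k : Fin 3) (x : R3) :
    |inner ℝ (ψ x) (weakPartial k ψ x)| ≤ ‖ψ x‖ * (ħ⁻¹ * ‖covDeriv ħ c Q A ψ k x‖) := by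
  have hcs := abs_real_inner_le_norm (Complex.I • ψ x) (covDeriv ħ c Q A ψ k x)
  rw [inner_I_smul_covDeriv, abs_mul, abs_of_pos hħ, norm_smul, Complex.norm_I, one_mul] at hcs
  rw [mul_left_comm, ← div_eq_inv_mul, le_div_iff₀' hħ]
  exact hcs

theorem exists_lpNorm_six_le_kineticNormSq (hħ : 0 < ħ) :
    ∃ C : ℝ, 0 < C ∧ ∀ (c Q : ℝ) (A : R3 → R3) (ψ : R3 → C2), MemH1 ψ →
      (∀ k, MemLp (covDeriv ħ c Q A ψ k) 2) →
        lpNorm ψ 6 volume ≤ C * √(kineticNormSq ħ c Q .S A ψ) := by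
  obtain ⟨C, hC⟩ := exists_eLpNorm_six_le_of_abs_inner_le C2
  refine ⟨C * ‖ħ⁻¹‖₊ * √3 + 1, by positivity, fun c Q A ψ hψ hcov => ?_⟩
  have hle : eLpNorm ψ 6 volume ≤
      (C * ‖ħ⁻¹‖₊ : ℝ≥0) * ∑ k : Fin 3, eLpNorm (covDeriv ħ c Q A ψ k) 2 volume := by
    refine (hC ψ (fun k x => ħ⁻¹ * ‖covDeriv ħ c Q A ψ k x‖) hψ fun k =>
      ae_of_all _ fun x => abs_inner_weakPartial_le hħ k x).trans_eq ?_
    have hscale (k : Fin 3) : eLpNorm (fun x => ħ⁻¹ * ‖covDeriv ħ c Q A ψ k x‖) 2 volume =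
        ‖ħ⁻¹‖₊ * eLpNorm (covDeriv ħ c Q A ψ k) 2 volume := by
      rw [← eLpNorm_norm (covDeriv ħ c Q A ψ k)]
      exact eLpNorm_const_smul ħ⁻¹ (fun x => ‖covDeriv ħ c Q A ψ k x‖) 2 volume
    simp only [hscale, ← Finset.mul_sum, ENNReal.coe_mul, mul_assoc]
  exact (lpNorm_six_le_of_eLpNorm_le hψ.memLp.1 hcov hle).trans
    (mul_le_mul_of_nonneg_right (lt_add_one _).le (Real.sqrt_nonneg _))

end Covariant

section TestApprox

variable {F : Type*} [NormedAddCommGroup F] [NormedSpace ℝ F] [CompleteSpace F] {f : R3 → F}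

theorem tendstoInLp_testApprox {p : ℝ≥0∞} [Fact (1 ≤ p)] (hp : p ≠ ⊤) (hf : MemLp f p) :
    TendstoInLp p volume (testApprox f) f where
  memLp n := (contDiff_testApprox (hf.locallyIntegrable Fact.out) n).continuous
    |>.memLp_of_hasCompactSupport (hasCompactSupport_testApprox f n)
  memLp_limit := hf
  tendsto := tendsto_eLpNorm_testApprox_sub hp hf

theorem MemH1.tendstoInLp_weakPartial_testApprox (hf : MemH1 f) (k : Fin 3) :
    TendstoInLp 2 volume (fun n => weakPartial k (testApprox f n)) (weakPartial k f) := by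
  have hsmooth (n : ℕ) := (contDiff_testApprox (hf.memLp.locallyIntegrable one_le_two) n).of_le
    (m := 1) (by simp)
  have hpartial (n : ℕ) :
      weakPartial k (testApprox f n) =ᵐ[volume] partialDeriv k (testApprox f n) :=
    weakPartial_ae_eq (HasWeakPartial.of_contDiff (hsmooth n))
  refine ⟨fun n => ?_, hf.memLp_weakPartial k, ?_⟩
  · exact (memLp_congr_ae (hpartial n)).2 ((continuous_partialDeriv (hsmooth n))
      |>.memLp_of_hasCompactSupport
        (hasCompactSupport_partialDeriv (hasCompactSupport_testApprox f n)))
  · simp only [eLpNorm_congr_ae ((hpartial _).sub (ae_eq_refl (weakPartial k f)))]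
    exact tendsto_eLpNorm_partialDeriv_testApprox_sub (by simp) (hf.hasWeakPartial k) hf.memLp
      (hf.memLp_weakPartial k)

variable {ħ c Q : ℝ} {A : R3 → R3} {ψ : R3 → C2}

theorem MemH1.tendstoInLp_covDeriv_testApprox (hψ : MemH1 ψ) (hA : MemLp A 6) (w : R3)
    (k : Fin 3) :
    TendstoInLp 2 volume (fun n => covDeriv ħ c Q (fun x => A x + w) (testApprox ψ n) k)
      (covDeriv ħ c Q (fun x => A x + w) ψ k) := by
  have : Fact ((1 : ℝ≥0∞) ≤ 3) := ⟨by norm_num⟩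
  have hAk : MemLp (fun x => Q / c * A x k) 6 :=
    ((EuclideanSpace.proj k : R3 →L[ℝ] ℝ).comp_memLp' hA).const_mul _
  have hgrad := (hψ.tendstoInLp_weakPartial_testApprox k).clm
    ((Complex.I * (ħ : ℂ)) • ContinuousLinearMap.id ℝ C2)
  have hpotential := (TendstoInLp.const hAk).bilin (r := 2) (ContinuousLinearMap.lsmul ℝ ℝ)
    (tendstoInLp_testApprox (by simp) hψ.memLp_three)
  have hconst := (tendstoInLp_testApprox (by simp) hψ.memLp).clm
    ((Q / c * w k) • ContinuousLinearMap.id ℝ C2)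
  have hsum := (hgrad.add hpotential).add hconst
  have hcov (u : R3 → C2) := funext (covDeriv_add_const ħ c Q A w u k)
  simp only [hcov]
  exact hsum

theorem MemH1.memLp_covDeriv (hψ : MemH1 ψ) (hA : MemLp A 6) (w : R3) (k : Fin 3) :
    MemLp (covDeriv ħ c Q (fun x => A x + w) ψ k) 2 :=
  (hψ.tendstoInLp_covDeriv_testApprox hA w k).memLp_limit

end TestApprox

/-! ### The Lichnerowicz identity -/

section PauliAlgebra

/-- The Pauli matrix `σᵏ` as a continuous linear operator on spinors. -/
def sigma (k : Fin 3) : C2 →L[ℂ] C2 :=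
  LinearMap.toContinuousLinearMap (Matrix.toEuclideanLin (pauli k))

theorem sigma_apply_zero (k : Fin 3) (z : C2) :
    sigma k z 0 = pauli k 0 0 * z 0 + pauli k 0 1 * z 1 := by
  simp [sigma, Matrix.toLpLin_apply]

theorem sigma_apply_one (k : Fin 3) (z : C2) :
    sigma k z 1 = pauli k 1 0 * z 0 + pauli k 1 1 * z 1 := by
  simp [sigma, Matrix.toLpLin_apply]

/-- The real-linear operator `i σᵏ` on spinors, which is skew-adjoint for the real inner product. -/
def iSigma (k : Fin 3) : C2 →L[ℝ] C2 :=
  (Complex.I • sigma k).restrictScalars ℝ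

theorem isHermitian_pauli (k : Fin 3) : (pauli k).IsHermitian := by
  fin_cases k <;> ext i j <;> fin_cases i <;> fin_cases j <;> simp [pauli]

theorem inner_sigma_left (k : Fin 3) (y z : C2) : inner ℂ (sigma k y) z = inner ℂ y (sigma k z) :=
  Matrix.isSymmetric_toEuclideanLin_iff.2 (isHermitian_pauli k) y z

theorem real_inner_sigma_left (k : Fin 3) (y z : C2) :
    inner ℝ (sigma k y) z = inner ℝ y (sigma k z) :=
  congrArg Complex.re (inner_sigma_left k y z)

theorem inner_iSigma_left (k : Fin 3) (y z : C2) :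
    inner ℝ (iSigma k y) z = -inner ℝ y (iSigma k z) := by
  have hskew : inner ℂ (Complex.I • sigma k y) z = -inner ℂ y (Complex.I • sigma k z) := by
    rw [inner_smul_left, inner_smul_right, inner_sigma_left, Complex.conj_I, neg_mul]
  exact congrArg Complex.re hskew

/-- The spin density `⟨z, σ z⟩` of a spinor. -/
def spin (z : C2) : R3 := WithLp.toLp 2 fun k => inner ℝ z (sigma k z)

theorem norm_sq_eq_re_im (z : C2) :
    ‖z‖ ^ 2 = (z 0).re ^ 2 + (z 0).im ^ 2 + ((z 1).re ^ 2 + (z 1).im ^ 2) := by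
  rw [EuclideanSpace.norm_sq_eq, Fin.sum_univ_two, ← Complex.normSq_eq_norm_sq,
    ← Complex.normSq_eq_norm_sq, Complex.normSq_apply, Complex.normSq_apply]
  ring

theorem inner_eq_re_im (y z : C2) :
    inner ℝ y z = (y 0).re * (z 0).re + (y 0).im * (z 0).im +
      ((y 1).re * (z 1).re + (y 1).im * (z 1).im) := by
  change (inner ℂ y z).re = _
  simp [PiLp.inner_apply, Fin.sum_univ_two]
  ring

theorem norm_spin (z : C2) : ‖spin z‖ = ‖z‖ ^ 2 := by
  refine (sq_eq_sq₀ (norm_nonneg _) (sq_nonneg _)).1 ?_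
  rw [EuclideanSpace.norm_sq_eq, Fin.sum_univ_three, norm_sq_eq_re_im]
  simp [spin, inner_eq_re_im, sigma_apply_zero, sigma_apply_one, pauli]
  ring

-- Reflects `σᵏ σˡ = i σᵐ` for the cyclic permutations `(k, l, m)` of the axes.
theorem norm_sum_sigma_sq (D : Fin 3 → C2) :
    ‖∑ k, sigma k (D k)‖ ^ 2 =
      ∑ k, ‖D k‖ ^ 2 + ∑ m, 2 * inner ℝ (D (m + 1)) (iSigma m (D (m + 2))) := by
  simp [Fin.sum_univ_three, norm_sq_eq_re_im, inner_eq_re_im, iSigma, sigma_apply_zero,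
    sigma_apply_one, pauli]
  ring

theorem curl_apply (A : R3 → R3) (x : R3) (m : Fin 3) :
    curl A x m = weakPartial (m + 1) A x (m + 2) - weakPartial (m + 2) A x (m + 1) := by
  fin_cases m <;> rfl

theorem two_mul_inner_iSigma (m : Fin 3) (ħ a b : ℝ) (y y' z : C2) :
    2 * inner ℝ ((Complex.I * (ħ : ℂ)) • y + (a : ℂ) • z)
        (iSigma m ((Complex.I * (ħ : ℂ)) • y' + (b : ℂ) • z)) =
      2 * ħ ^ 2 * inner ℝ y (iSigma m y') +
        ħ * (b * (2 * inner ℝ y (sigma m z)) - a * (2 * inner ℝ y' (sigma m z))) := by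
  fin_cases m <;> simp [inner_eq_re_im, iSigma, sigma_apply_zero, sigma_apply_one, pauli] <;> ring

end PauliAlgebra

section IntegrationByParts

variable {F : Type*} [NormedAddCommGroup F] {k l : Fin 3} {u : R3 → F}

theorem partialDeriv_comm [NormedSpace ℝ F] (hu : ContDiff ℝ ∞ u) (k l : Fin 3) :
    partialDeriv k (partialDeriv l u) = partialDeriv l (partialDeriv k u) := by
  funext x
  have hdiff : DifferentiableAt ℝ (fderiv ℝ u) x :=
    (hu.fderiv_right (m := ∞) (by simp)).differentiable (by simp) x
  have hsecond (i j : Fin 3) : partialDeriv i (partialDeriv j u) x =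
      fderiv ℝ (fderiv ℝ u) x (EuclideanSpace.single i 1) (EuclideanSpace.single j 1) := by
    rw [partialDeriv, show partialDeriv j u = fun y => fderiv ℝ u y (EuclideanSpace.single j 1) from
      rfl, fderiv_clm_apply hdiff (differentiableAt_const _)]
    simp
  have hsmooth : minSmoothness ℝ 2 ≤ (∞ : WithTop ℕ∞) := by
    rw [minSmoothness_of_isRCLikeNormedField]
    exact WithTop.coe_le_coe.2 le_top
  rw [hsecond, hsecond]
  exact hu.contDiffAt.isSymmSndFDerivAt hsmooth _ _

theorem integral_inner_partialDeriv [InnerProductSpace ℝ F] {w : R3 → F} (hu : ContDiff ℝ ∞ u)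
    (huc : HasCompactSupport u) (hw : ContDiff ℝ ∞ w) (k : Fin 3) :
    ∫ x, inner ℝ (u x) (partialDeriv k w x) = -∫ x, inner ℝ (partialDeriv k u x) (w x) := by
  have hint {f g : R3 → F} (hf : Continuous f) (hfc : HasCompactSupport f) (hg : Continuous g) :
      Integrable fun x => innerSL ℝ (f x) (g x) :=
    (hf.inner hg).integrable_of_hasCompactSupport (hfc.mono' fun x hx =>
      subset_tsupport f fun h0 => hx (by simp [h0]))
  have hu' := contDiff_partialDeriv (k := k) hu
  have hw' := contDiff_partialDeriv (k := k) hw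
  exact integral_bilinear_fderiv_right_eq_neg_left_of_integrable (B := innerSL ℝ)
    (hint hu'.continuous (hasCompactSupport_partialDeriv huc) hw.continuous)
    (hint hu.continuous huc hw'.continuous) (hint hu.continuous huc hw.continuous)
    (fun x _ => hu.differentiable (by simp) x) (fun x _ => hw.differentiable (by simp) x)

-- Integrating by parts in either variable gives the same second-order integral up to sign.
theorem integral_inner_partialDeriv_skew [InnerProductSpace ℝ F] (hu : ContDiff ℝ ∞ u)
    (huc : HasCompactSupport u) {T : F →L[ℝ] F} (hT : ∀ y z, inner ℝ (T y) z = -inner ℝ y (T z))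
    (k l : Fin 3) : ∫ x, inner ℝ (partialDeriv k u x) (T (partialDeriv l u x)) = 0 := by
  have hTu : ContDiff ℝ ∞ fun x => T (u x) := T.contDiff.comp hu
  have hcomm (i : Fin 3) : partialDeriv i (fun x => T (u x)) = fun x => T (partialDeriv i u x) := by
    funext x
    rw [partialDeriv, fderiv_fun_comp x T.differentiableAt (hu.differentiable (by simp) x),
      T.fderiv]
    rfl
  have hparts (i j : Fin 3) : ∫ x, inner ℝ (partialDeriv i u x) (T (partialDeriv j u x)) =
      -∫ x, inner ℝ (partialDeriv j (partialDeriv i u) x) (T (u x)) := by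
    rw [← integral_inner_partialDeriv (contDiff_partialDeriv hu)
      (hasCompactSupport_partialDeriv huc) hTu, hcomm]
  have hswap : ∫ x, inner ℝ (partialDeriv k u x) (T (partialDeriv l u x)) =
      -∫ x, inner ℝ (partialDeriv l u x) (T (partialDeriv k u x)) := by
    rw [← integral_neg]
    exact integral_congr_ae (ae_of_all _ fun x => (real_inner_comm _ _).trans (hT _ _))
  have hsame := hparts k l
  rw [partialDeriv_comm hu l k, ← hparts l k] at hsame
  linarith

end IntegrationByParts

section Lichnerowicz

variable {ħ c Q : ℝ} {A : R3 → R3} {ψ : R3 → C2}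

theorem HasWeakPartial.coord_add_const {k : Fin 3} {G : R3 → R3} (hA : HasWeakPartial k A G)
    (w : R3) (l : Fin 3) : HasWeakPartial k (fun x => A x l + w l) fun x => G x l := by
  let proj : R3 →L[ℝ] ℝ := EuclideanSpace.proj l
  have hfderiv (z : R3) : fderiv ℝ (fun y => proj y + w l) z = proj := by simp
  have hcomp := hA.comp_contDiff (Φ := fun y => proj y + w l) (C := ‖proj‖₊)
    (proj.contDiff.add contDiff_const) fun z => by rw [hfderiv z]; rfl
  simp only [hfderiv] at hcomp
  exact hcomp

theorem contDiff_spin_comp {u : R3 → C2} (hu : ContDiff ℝ ∞ u) (m : Fin 3) :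
    ContDiff ℝ ∞ fun x => spin (u x) m :=
  hu.inner ℝ (((sigma m).restrictScalars ℝ).contDiff.comp hu)

theorem hasCompactSupport_spin_comp {u : R3 → C2} (hu : HasCompactSupport u) (m : Fin 3) :
    HasCompactSupport fun x => spin (u x) m :=
  hu.comp_left (g := fun z => spin z m) (by simp [spin])

theorem partialDeriv_spin_comp {u : R3 → C2} (hu : ContDiff ℝ ∞ u) (k m : Fin 3) (x : R3) :
    partialDeriv k (fun y => spin (u y) m) x =
      2 * inner ℝ (partialDeriv k u x) (sigma m (u x)) := by
  have hux : DifferentiableAt ℝ u x := hu.differentiable (by simp) x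
  let T : C2 →L[ℝ] C2 := (sigma m).restrictScalars ℝ
  have hTu : DifferentiableAt ℝ (fun y => T (u y)) x := T.differentiableAt.comp x hux
  have hT : fderiv ℝ (fun y => T (u y)) x = T.comp (fderiv ℝ u x) := by
    rw [fderiv_fun_comp x T.differentiableAt hux, T.fderiv]
  calc partialDeriv k (fun y => inner ℝ (u y) (T (u y))) x
      = inner ℝ (u x) (T (partialDeriv k u x)) + inner ℝ (partialDeriv k u x) (T (u x)) := by
        rw [partialDeriv, fderiv_inner_apply ℝ hux hTu, hT]
        rfl
    _ = 2 * inner ℝ (partialDeriv k u x) (sigma m (u x)) := by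
        rw [two_mul, real_inner_comm]
        exact congrArg (· + _) (real_inner_sigma_left m _ _)

theorem two_mul_inner_covDeriv_ae_eq (w : R3) {u : R3 → C2} (hu : ContDiff ℝ ∞ u) (m : Fin 3) :
    (fun x => 2 * inner ℝ (covDeriv ħ c Q (fun y => A y + w) u (m + 1) x)
        (iSigma m (covDeriv ħ c Q (fun y => A y + w) u (m + 2) x))) =ᵐ[volume] fun x =>
      2 * ħ ^ 2 * inner ℝ (partialDeriv (m + 1) u x) (iSigma m (partialDeriv (m + 2) u x)) +
        ħ * (Q / c) * (partialDeriv (m + 1) (fun y => spin (u y) m) x * (A x (m + 2) + w (m + 2)) -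
          partialDeriv (m + 2) (fun y => spin (u y) m) x * (A x (m + 1) + w (m + 1))) := by
  have hpartial (k : Fin 3) : weakPartial k u =ᵐ[volume] partialDeriv k u :=
    weakPartial_ae_eq (.of_contDiff (hu.of_le (by simp)))
  filter_upwards [hpartial (m + 1), hpartial (m + 2)] with x h1 h2
  rw [covDeriv, covDeriv, two_mul_inner_iSigma, h1, h2, partialDeriv_spin_comp hu,
    partialDeriv_spin_comp hu]
  simp only [PiLp.add_apply]
  ring

theorem MemD1.two_mul_integral_inner_covDeriv_of_contDiff (hA : MemD1 A) (w : R3) {u : R3 → C2}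
    (hu : ContDiff ℝ ∞ u) (huc : HasCompactSupport u) (m : Fin 3) :
    2 * ∫ x, inner ℝ (covDeriv ħ c Q (fun y => A y + w) u (m + 1) x)
        (iSigma m (covDeriv ħ c Q (fun y => A y + w) u (m + 2) x)) =
      -(ħ * (Q / c)) * ∫ x, curl A x m * spin (u x) m := by
  set s : R3 → ℝ := fun x => spin (u x) m
  have hs : ContDiff ℝ ∞ s := contDiff_spin_comp hu m
  have hsc : HasCompactSupport s := hasCompactSupport_spin_comp huc m
  have hu' (k : Fin 3) : ContDiff ℝ ∞ (partialDeriv k u) := contDiff_partialDeriv hu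
  have hskew : Integrable fun x =>
      inner ℝ (partialDeriv (m + 1) u x) (iSigma m (partialDeriv (m + 2) u x)) :=
    ((hu' _).continuous.inner ((iSigma m).continuous.comp (hu' _).continuous))
      |>.integrable_of_hasCompactSupport ((hasCompactSupport_partialDeriv huc).mono' fun x hx =>
        subset_tsupport (partialDeriv (m + 1) u) fun h0 => hx (by simp [h0]))
  have hcoord (k l : Fin 3) := (hA.hasWeakPartial k).coord_add_const w l
  have hAs (k l : Fin 3) : Integrable fun x => partialDeriv k s x * (A x l + w l) :=
    (hcoord k l).locallyIntegrable.integrable_smul_left_of_hasCompactSupport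
      (contDiff_partialDeriv hs).continuous (hasCompactSupport_partialDeriv hsc)
  have hdA (k l : Fin 3) : Integrable fun x => s x * weakPartial k A x l :=
    (hcoord k l).locallyIntegrable_deriv.integrable_smul_left_of_hasCompactSupport
      hs.continuous hsc
  have hparts (k l : Fin 3) : ∫ x, partialDeriv k s x * (A x l + w l) =
      -∫ x, s x * weakPartial k A x l := (hcoord k l).integral_eq s hs hsc
  calc 2 * ∫ x, inner ℝ (covDeriv ħ c Q (fun y => A y + w) u (m + 1) x)
        (iSigma m (covDeriv ħ c Q (fun y => A y + w) u (m + 2) x))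
      = ħ * (Q / c) * ((∫ x, partialDeriv (m + 1) s x * (A x (m + 2) + w (m + 2))) -
          ∫ x, partialDeriv (m + 2) s x * (A x (m + 1) + w (m + 1))) := by
        have hdiff := ((hAs (m + 1) (m + 2)).sub' (hAs (m + 2) (m + 1))).const_mul (ħ * (Q / c))
        rw [← integral_const_mul, integral_congr_ae (two_mul_inner_covDeriv_ae_eq w hu m),
          integral_add (hskew.const_mul _) hdiff, integral_const_mul, integral_const_mul,
          integral_inner_partialDeriv_skew hu huc (inner_iSigma_left m), mul_zero, zero_add,
          integral_sub (hAs _ _) (hAs _ _)]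
    _ = -(ħ * (Q / c)) * ((∫ x, s x * weakPartial (m + 1) A x (m + 2)) -
          ∫ x, s x * weakPartial (m + 2) A x (m + 1)) := by
        rw [hparts, hparts]
        ring
    _ = -(ħ * (Q / c)) * ∫ x, curl A x m * spin (u x) m := by
        rw [← integral_sub (hdA _ _) (hdA _ _)]
        simp only [curl_apply, sub_mul, mul_comm (s _), s]

theorem MemD1.memLp_curl_apply (hA : MemD1 A) (m : Fin 3) : MemLp (fun x => curl A x m) 2 := by
  have hcoord (k l : Fin 3) : MemLp (fun x => weakPartial k A x l) 2 :=
    (EuclideanSpace.proj l : R3 →L[ℝ] ℝ).comp_memLp' (hA.memLp_weakPartial k)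
  simp only [curl_apply]
  exact (hcoord _ _).sub (hcoord _ _)

theorem MemD1.two_mul_integral_inner_covDeriv (hA : MemD1 A) (hψ : MemH1 ψ) (w : R3) (m : Fin 3) :
    2 * ∫ x, inner ℝ (covDeriv ħ c Q (fun y => A y + w) ψ (m + 1) x)
        (iSigma m (covDeriv ħ c Q (fun y => A y + w) ψ (m + 2) x)) =
      -(ħ * (Q / c)) * ∫ x, curl A x m * spin (ψ x) m := by
  have : Fact ((1 : ℝ≥0∞) ≤ 4) := ⟨by norm_num⟩
  have hcov (k : Fin 3) := hψ.tendstoInLp_covDeriv_testApprox (ħ := ħ) (c := c) (Q := Q)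
    hA.memLp_six w k
  have hψ4 := tendstoInLp_testApprox (by simp) hψ.memLp_four
  have hspin := hψ4.bilin (r := 2) (innerSL ℝ) (hψ4.clm ((sigma m).restrictScalars ℝ))
  have hleft := ((hcov (m + 1)).bilin (r := 1) (innerSL ℝ)
    ((hcov (m + 2)).clm (iSigma m))).tendsto_integral.const_mul 2
  have hright := ((TendstoInLp.const (hA.memLp_curl_apply m)).bilin (r := 1)
    (ContinuousLinearMap.mul ℝ ℝ) hspin).tendsto_integral.const_mul (-(ħ * (Q / c)))
  refine tendsto_nhds_unique hleft (hright.congr fun n => ?_)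
  exact (hA.two_mul_integral_inner_covDeriv_of_contDiff w
    (contDiff_testApprox (hψ.memLp.locallyIntegrable one_le_two) n)
    (hasCompactSupport_testApprox ψ n) m).symm

theorem MemH1.memLp_spin_apply (hψ : MemH1 ψ) (m : Fin 3) : MemLp (fun x => spin (ψ x) m) 2 :=
  (innerSL ℝ : C2 →L[ℝ] C2 →L[ℝ] ℝ).memLp_of_bilin 2 hψ.memLp_four
    (((sigma m).restrictScalars ℝ).comp_memLp' hψ.memLp_four)

theorem MemD1.integrable_curl_mul_spin (hA : MemD1 A) (hψ : MemH1 ψ) (m : Fin 3) :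
    Integrable fun x => curl A x m * spin (ψ x) m :=
  (hA.memLp_curl_apply m).integrable_mul (hψ.memLp_spin_apply m)

theorem kineticNormSq_P_eq (hA : MemD1 A) (hψ : MemH1 ψ) (w : R3) :
    kineticNormSq ħ c Q .P (fun x => A x + w) ψ = kineticNormSq ħ c Q .S (fun x => A x + w) ψ -
      ħ * (Q / c) * ∫ x, inner ℝ (curl A x) (spin (ψ x)) := by
  set D := covDeriv ħ c Q (fun x => A x + w) ψ with hD
  have hD2 (k : Fin 3) : MemLp (D k) 2 := hψ.memLp_covDeriv hA.memLp_six w k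
  have hsq (k : Fin 3) : Integrable fun x => ‖D k x‖ ^ 2 := (hD2 k).integrable_norm_pow two_ne_zero
  have hcross (m : Fin 3) :
      Integrable fun x => 2 * inner ℝ (D (m + 1) x) (iSigma m (D (m + 2) x)) :=
    (memLp_one_iff_integrable.1 ((innerSL ℝ : C2 →L[ℝ] C2 →L[ℝ] ℝ).memLp_of_bilin 1
      (hD2 (m + 1)) ((iSigma m).comp_memLp' (hD2 (m + 2))))).const_mul 2
  calc ∫ x, ‖∑ k, sigma k (D k x)‖ ^ 2
      = ∑ k, (∫ x, ‖D k x‖ ^ 2) + ∑ m, 2 * ∫ x, inner ℝ (D (m + 1) x) (iSigma m (D (m + 2) x)) := by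
        simp only [norm_sum_sigma_sq, ← integral_const_mul]
        rw [← integral_finsetSum _ fun k _ => hsq k, ← integral_finsetSum _ fun m _ => hcross m]
        exact integral_add (integrable_finsetSum _ fun k _ => hsq k)
          (integrable_finsetSum _ fun m _ => hcross m)
    _ = ∑ k, (∫ x, ‖D k x‖ ^ 2) - ħ * (Q / c) * ∑ m, ∫ x, curl A x m * spin (ψ x) m := by
        simp only [hD, hA.two_mul_integral_inner_covDeriv hψ w, ← Finset.mul_sum]
        ring
    _ = ∑ k, normSqL2 (D k) - ħ * (Q / c) * ∫ x, inner ℝ (curl A x) (spin (ψ x)) := by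
        rw [← integral_finsetSum _ fun m _ => hA.integrable_curl_mul_spin hψ m]
        simp only [normSqL2, PiLp.inner_apply, RCLike.inner_apply, conj_trivial, mul_comm]

end Lichnerowicz

/-! ### Galilean boosts -/

section Boost

variable {ħ c Q : ℝ} {A : R3 → R3} {ψ : R3 → C2}

/-- The expectation `⟨ψ, (iħ∇ + (Q/c) A) ψ⟩` of the kinetic momentum. -/
def momentum (ħ c Q : ℝ) (A : R3 → R3) (ψ : R3 → C2) : R3 :=
  WithLp.toLp 2 fun k => ∫ x, inner ℝ (ψ x) (covDeriv ħ c Q A ψ k x)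

theorem kineticNormSq_nonneg (ħ c Q : ℝ) (j : Model) (A : R3 → R3) (ψ : R3 → C2) :
    0 ≤ kineticNormSq ħ c Q j A ψ := by
  cases j with
  | S => exact Finset.sum_nonneg fun k _ => normSqL2_nonneg _
  | P => exact normSqL2_nonneg _

theorem integrable_inner_of_memLp_two {H : Type*} [NormedAddCommGroup H] [InnerProductSpace ℝ H]
    {f g : R3 → H} (hf : MemLp f 2) (hg : MemLp g 2) :
    Integrable fun x => inner ℝ (f x) (g x) :=
  memLp_one_iff_integrable.1 ((innerSL ℝ : H →L[ℝ] H →L[ℝ] ℝ).memLp_of_bilin 1 hf hg)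

theorem sq_integral_inner_le {H : Type*} [NormedAddCommGroup H] [InnerProductSpace ℝ H]
    {f g : R3 → H} (hf : MemLp f 2) (hg : MemLp g 2) :
    (∫ x, inner ℝ (f x) (g x)) ^ 2 ≤ normSqL2 f * normSqL2 g := by
  have hfg : AEStronglyMeasurable (fun x => ‖f x‖ * ‖g x‖) := hf.1.norm.mul hg.1.norm
  have hle : |∫ x, inner ℝ (f x) (g x)| ≤ lpNorm f 2 volume * lpNorm g 2 volume :=
    calc |∫ x, inner ℝ (f x) (g x)|
        ≤ ∫ x, ‖f x‖ * ‖g x‖ := norm_integral_le_of_norm_le (hf.norm.integrable_mul hg.norm)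
          (ae_of_all _ fun x => norm_inner_le_norm (𝕜 := ℝ) (f x) (g x))
      _ = lpNorm (fun x => ‖f x‖ * ‖g x‖) 1 volume := by
        simp [lpNorm_one_eq_integral_norm hfg]
      _ ≤ lpNorm (fun x => ‖f x‖) 2 volume * lpNorm (fun x => ‖g x‖) 2 volume :=
        lpNorm_mul_le hf.norm hg.norm
      _ = lpNorm f 2 volume * lpNorm g 2 volume := by rw [lpNorm_norm hf.1, lpNorm_norm hg.1]
  rw [normSqL2_eq_lpNorm_sq hf.1, normSqL2_eq_lpNorm_sq hg.1, ← mul_pow, ← sq_abs]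
  exact pow_le_pow_left₀ (abs_nonneg _) hle 2

theorem norm_momentum_le (hψ : MemLp ψ 2) (hcov : ∀ k, MemLp (covDeriv ħ c Q A ψ k) 2) :
    ‖momentum ħ c Q A ψ‖ ≤ √(normSqL2 ψ) * √(kineticNormSq ħ c Q .S A ψ) := by
  rw [← Real.sqrt_mul (normSqL2_nonneg ψ), EuclideanSpace.norm_eq]
  refine Real.sqrt_le_sqrt ?_
  rw [kineticNormSq, Finset.mul_sum]
  refine Finset.sum_le_sum fun k _ => ?_
  rw [Real.norm_eq_abs, sq_abs]
  exact sq_integral_inner_le hψ (hcov k)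

theorem kineticNormSq_S_eq_add_const (hψ : MemH1 ψ) (hA : MemLp A 6) (w : R3) :
    kineticNormSq ħ c Q .S A ψ = kineticNormSq ħ c Q .S (fun x => A x + w) ψ -
      2 * (Q / c) * inner ℝ w (momentum ħ c Q (fun x => A x + w) ψ) +
        (Q / c) ^ 2 * ‖w‖ ^ 2 * normSqL2 ψ := by
  set D := covDeriv ħ c Q (fun x => A x + w) ψ
  have hD (k : Fin 3) : MemLp (D k) 2 := hψ.memLp_covDeriv hA w k
  have hcomponent (k : Fin 3) : normSqL2 (covDeriv ħ c Q A ψ k) =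
      normSqL2 (D k) - 2 * (Q / c * w k) * (∫ x, inner ℝ (ψ x) (D k x)) +
        (Q / c * w k) ^ 2 * normSqL2 ψ := by
    have hpoint (x : R3) : ‖covDeriv ħ c Q A ψ k x‖ ^ 2 = ‖D k x‖ ^ 2 -
        2 * (Q / c * w k) * inner ℝ (ψ x) (D k x) + (Q / c * w k) ^ 2 * ‖ψ x‖ ^ 2 := by
      have hshift : covDeriv ħ c Q A ψ k x = D k x - (Q / c * w k) • ψ x :=
        eq_sub_of_add_eq (covDeriv_add_const ħ c Q A w ψ k x).symm
      rw [hshift, norm_sub_sq_real, real_inner_smul_right, real_inner_comm, norm_smul, mul_pow,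
        Real.norm_eq_abs, sq_abs]
      ring
    have hDsq := (hD k).integrable_norm_pow two_ne_zero
    have hinner := (integrable_inner_of_memLp_two hψ.memLp (hD k)).const_mul (2 * (Q / c * w k))
    have hψsq := (hψ.memLp.integrable_norm_pow two_ne_zero).const_mul ((Q / c * w k) ^ 2)
    simp only [normSqL2, hpoint]
    rw [integral_add (hDsq.sub' hinner) hψsq, integral_sub hDsq hinner, integral_const_mul,
      integral_const_mul]
  simp only [kineticNormSq, hcomponent, EuclideanSpace.norm_sq_eq, momentum, PiLp.inner_apply,
    Fin.sum_univ_three, RCLike.inner_apply, conj_trivial, Real.norm_eq_abs, sq_abs]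
  ring

-- By the Lichnerowicz identity the spin contribution does not see a constant shift of `A`.
theorem kineticNormSq_eq_add_const (j : Model) (hψ : MemH1 ψ) (hA : MemD1 A) (w : R3) :
    kineticNormSq ħ c Q j A ψ = kineticNormSq ħ c Q j (fun x => A x + w) ψ -
      2 * (Q / c) * inner ℝ w (momentum ħ c Q (fun x => A x + w) ψ) +
        (Q / c) ^ 2 * ‖w‖ ^ 2 * normSqL2 ψ := by
  have hS := kineticNormSq_S_eq_add_const (ħ := ħ) (c := c) (Q := Q) hψ hA.memLp_six w
  cases j with
  | S => exact hS
  | P =>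
    have hP := kineticNormSq_P_eq (ħ := ħ) (c := c) (Q := Q) hA hψ 0
    simp only [add_zero] at hP
    rw [hP, hS, kineticNormSq_P_eq hA hψ]
    ring

theorem MemH1.memLp_norm_mul_norm {E : Type*} [NormedAddCommGroup E] {f : R3 → E}
    (hψ : MemH1 ψ) (hf : MemLp f 6) :
    MemLp (fun x => ‖f x‖ * ‖ψ x‖) 2 :=
  hψ.memLp_three.norm.mul hf.norm

theorem MemH1.integrable_inner_mul_norm_sq (hψ : MemH1 ψ) (hA : MemLp A 6) (v : R3) :
    Integrable fun x => inner ℝ v (A x) * ‖ψ x‖ ^ 2 := by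
  have hmajorant := ((hψ.memLp_norm_mul_norm hA).integrable_mul hψ.memLp.norm).const_mul ‖v‖
  refine hmajorant.mono ((hA.1.const_inner (c := v)).mul (hψ.memLp.1.norm.pow 2))
    (ae_of_all _ fun x => ?_)
  have hcs := norm_inner_le_norm (𝕜 := ℝ) v (A x)
  calc ‖inner ℝ v (A x) * ‖ψ x‖ ^ 2‖
      = ‖inner ℝ v (A x)‖ * ‖ψ x‖ ^ 2 := by simp
    _ ≤ ‖v‖ * ‖A x‖ * ‖ψ x‖ ^ 2 := by gcongr
    _ = ‖‖v‖ * (‖A x‖ * ‖ψ x‖ * ‖ψ x‖)‖ := by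
      rw [Real.norm_of_nonneg (by positivity)]
      ring

theorem sum_smul_covDeriv_add_const (ħ c Q : ℝ) (A : R3 → R3) (ψ : R3 → C2) (v w x : R3) :
    ∑ k, v k • covDeriv ħ c Q (fun y => A y + w) ψ k x =
      (Complex.I * (ħ : ℂ)) • dirDeriv v ψ x +
        (Q / c * (inner ℝ v (A x) + inner ℝ v w)) • ψ x := by
  simp only [covDeriv, dirDeriv, Fin.sum_univ_three, PiLp.inner_apply, RCLike.inner_apply,
    conj_trivial, PiLp.add_apply, Complex.coe_smul]
  simp only [smul_add, smul_comm (v _) (Complex.I * (ħ : ℂ))]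
  module

theorem sum_mul_inner_covDeriv_add_const (ħ c Q : ℝ) (A : R3 → R3) (ψ : R3 → C2) (v w x : R3) :
    ∑ k, v k * inner ℝ (ψ x) (covDeriv ħ c Q (fun y => A y + w) ψ k x) =
      (inner ℂ (ψ x) ((Complex.I * (ħ : ℂ)) • dirDeriv v ψ x)).re +
        Q / c * (inner ℝ v (A x) * ‖ψ x‖ ^ 2) + Q / c * inner ℝ v w * ‖ψ x‖ ^ 2 :=
  calc ∑ k, v k * inner ℝ (ψ x) (covDeriv ħ c Q (fun y => A y + w) ψ k x)
      = inner ℝ (ψ x) (∑ k, v k • covDeriv ħ c Q (fun y => A y + w) ψ k x) := by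
        simp only [inner_sum, real_inner_smul_right]
    _ = inner ℝ (ψ x) ((Complex.I * (ħ : ℂ)) • dirDeriv v ψ x) +
          Q / c * (inner ℝ v (A x) + inner ℝ v w) * ‖ψ x‖ ^ 2 := by
        rw [sum_smul_covDeriv_add_const, inner_add_right, real_inner_smul_right (ψ x) (ψ x),
          real_inner_self_eq_norm_sq]
    _ = inner ℝ (ψ x) ((Complex.I * (ħ : ℂ)) • dirDeriv v ψ x) +
          Q / c * (inner ℝ v (A x) * ‖ψ x‖ ^ 2) + Q / c * inner ℝ v w * ‖ψ x‖ ^ 2 := by ring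

theorem integrable_complex_inner_of_memLp_two {f g : R3 → C2} (hf : MemLp f 2)
    (hg : MemLp g 2) : Integrable fun x => inner ℂ (f x) (g x) :=
  (hf.norm.integrable_mul hg.norm).mono (hf.1.inner hg.1) <| ae_of_all _ fun x => by
    simpa using norm_inner_le_norm (𝕜 := ℂ) (f x) (g x)

theorem inner_momentum_add_const (hψ : MemH1 ψ) (hA : MemLp A 6) (v w : R3) :
    inner ℝ v (momentum ħ c Q (fun x => A x + w) ψ) =
      (∫ x, inner ℂ (ψ x) ((Complex.I * (ħ : ℂ)) • dirDeriv v ψ x)).re +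
        Q / c * (∫ x, inner ℝ v (A x) * ‖ψ x‖ ^ 2) + Q / c * inner ℝ v w * normSqL2 ψ := by
  set D := covDeriv ħ c Q (fun x => A x + w) ψ
  have hdir : MemLp (dirDeriv v ψ) 2 :=
    memLp_finsetSum _ fun k _ => (hψ.memLp_weakPartial k).const_smul (v k)
  have hT : Integrable fun x => inner ℂ (ψ x) ((Complex.I * (ħ : ℂ)) • dirDeriv v ψ x) :=
    integrable_complex_inner_of_memLp_two hψ.memLp (hdir.const_smul (Complex.I * (ħ : ℂ)))
  have hre : Integrable fun x => (inner ℂ (ψ x) ((Complex.I * (ħ : ℂ)) • dirDeriv v ψ x)).re :=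
    hT.re
  have hpotential := (hψ.integrable_inner_mul_norm_sq hA v).const_mul (Q / c)
  have hmass := (hψ.memLp.integrable_norm_pow two_ne_zero).const_mul (Q / c * inner ℝ v w)
  calc inner ℝ v (momentum ħ c Q (fun x => A x + w) ψ)
      = ∑ k, v k * ∫ x, inner ℝ (ψ x) (D k x) := by
        simp only [PiLp.inner_apply, RCLike.inner_apply, conj_trivial, momentum, mul_comm, D]
    _ = ∫ x, ∑ k, v k * inner ℝ (ψ x) (D k x) := by
        rw [integral_finsetSum _ fun k _ => (integrable_inner_of_memLp_two hψ.memLp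
          (hψ.memLp_covDeriv hA w k)).const_mul (v k)]
        simp only [integral_const_mul, D]
    _ = (∫ x, (inner ℂ (ψ x) ((Complex.I * (ħ : ℂ)) • dirDeriv v ψ x)).re) +
          Q / c * (∫ x, inner ℝ v (A x) * ‖ψ x‖ ^ 2) + Q / c * inner ℝ v w * normSqL2 ψ := by
        simp only [D, sum_mul_inner_covDeriv_add_const]
        rw [integral_add (by exact hre.add hpotential) hmass, integral_add hre hpotential,
          integral_const_mul, integral_const_mul, normSqL2]
    _ = _ := congrArg (· + _ + _) (integral_re hT)

end Boost

section MovingFrame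

variable {ħ c m Q : ℝ} {A : R3 → R3} {ψ : R3 → C2}

/-- The constant vector potential `(m c / Q) v`. Adding it to `A` turns `iħ∇ + (Q/c) A` into
`iħ∇ + (Q/c) A + m v`, the kinetic momentum relative to a frame moving with velocity `v` in the
sign convention of `covDeriv`. -/
def boostPotential (c m Q : ℝ) (v : R3) : R3 := (m * c / Q) • v

/-- The potential `A` seen from the frame moving with velocity `v`. -/
def boosted (c m Q : ℝ) (v : R3) (A : R3 → R3) (x : R3) : R3 := A x + boostPotential c m Q v

theorem inner_boostPotential (hc : c ≠ 0) (hQ : Q ≠ 0) (u v : R3) :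
    Q / c * inner ℝ u (boostPotential c m Q v) = m * inner ℝ u v := by
  rw [boostPotential, real_inner_smul_right]
  field_simp

theorem norm_boostPotential_sq (hc : c ≠ 0) (hQ : Q ≠ 0) (v : R3) :
    (Q / c) ^ 2 * ‖boostPotential c m Q v‖ ^ 2 = m ^ 2 * ‖v‖ ^ 2 := by
  rw [boostPotential, norm_smul, mul_pow, Real.norm_eq_abs, sq_abs]
  field_simp

theorem kineticNormSq_eq_boosted (hc : c ≠ 0) (hQ : Q ≠ 0) (j : Model) (hψ : MemH1 ψ)
    (hA : MemD1 A) (v : R3) :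
    kineticNormSq ħ c Q j A ψ = kineticNormSq ħ c Q j (boosted c m Q v A) ψ -
      2 * m * inner ℝ v (momentum ħ c Q (boosted c m Q v A) ψ) +
        m ^ 2 * ‖v‖ ^ 2 * normSqL2 ψ := by
  have hinner : Q / c * inner ℝ (boostPotential c m Q v) (momentum ħ c Q (boosted c m Q v A) ψ) =
      m * inner ℝ v (momentum ħ c Q (boosted c m Q v A) ψ) := by
    rw [real_inner_comm, inner_boostPotential hc hQ, real_inner_comm]
  have hkin : kineticNormSq ħ c Q j A ψ = kineticNormSq ħ c Q j (boosted c m Q v A) ψ - _ + _ :=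
    kineticNormSq_eq_add_const j hψ hA (boostPotential c m Q v)
  rw [hkin, norm_boostPotential_sq hc hQ, mul_assoc 2, mul_assoc 2 m, ← hinner]
  rfl

theorem functional_eq_boosted (hc : c ≠ 0) (hm : m ≠ 0) (hQ : Q ≠ 0) (j : Model) (hψ : MemH1 ψ)
    (hA : MemD1 A) (v : R3) :
    functional ħ c m Q j v ψ A =
      1 / (2 * m) * kineticNormSq ħ c Q j (boosted c m Q v A) ψ +
        1 / (8 * Real.pi) * (gradNormSq A - normSqL2 (dirDeriv (c⁻¹ • v) A)) -
          Q / c * (∫ x, inner ℝ v (A x) * ‖ψ x‖ ^ 2) - m * ‖v‖ ^ 2 / 2 * normSqL2 ψ := by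
  have hmomentum : inner ℝ v (momentum ħ c Q (boosted c m Q v A) ψ) = _ :=
    inner_momentum_add_const hψ hA.memLp_six v (boostPotential c m Q v)
  rw [inner_boostPotential hc hQ, real_inner_self_eq_norm_sq] at hmomentum
  rw [functional, kineticNormSq_eq_boosted (m := m) hc hQ j hψ hA v, hmomentum, gradNormSq]
  field_simp
  ring

theorem abs_kineticNormSq_sub_le (hc : c ≠ 0) (hm : 0 ≤ m) (hQ : Q ≠ 0) (j : Model)
    (hψ : MemH1 ψ) (hA : MemD1 A) (v : R3) :
    |kineticNormSq ħ c Q j A ψ - m ^ 2 * ‖v‖ ^ 2 * normSqL2 ψ| ≤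
      kineticNormSq ħ c Q j (boosted c m Q v A) ψ + 2 * m * ‖v‖ *
        (√(normSqL2 ψ) * √(kineticNormSq ħ c Q .S (boosted c m Q v A) ψ)) := by
  have hmomentum : ‖momentum ħ c Q (boosted c m Q v A) ψ‖ ≤ _ :=
    norm_momentum_le hψ.memLp (hψ.memLp_covDeriv hA.memLp_six (boostPotential c m Q v))
  rw [kineticNormSq_eq_boosted (m := m) hc hQ j hψ hA v, add_sub_cancel_right]
  calc |kineticNormSq ħ c Q j (boosted c m Q v A) ψ -
          2 * m * inner ℝ v (momentum ħ c Q (boosted c m Q v A) ψ)|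
      ≤ |kineticNormSq ħ c Q j (boosted c m Q v A) ψ| +
          |2 * m * inner ℝ v (momentum ħ c Q (boosted c m Q v A) ψ)| := abs_sub _ _
    _ ≤ kineticNormSq ħ c Q j (boosted c m Q v A) ψ +
          2 * m * (‖v‖ * ‖momentum ħ c Q (boosted c m Q v A) ψ‖) := by
        rw [abs_of_nonneg (kineticNormSq_nonneg _ _ _ _ _ _), abs_mul,
          abs_of_nonneg (by positivity : 0 ≤ 2 * m)]
        gcongr
        exact abs_real_inner_le_norm _ _
    _ ≤ _ := by
        rw [mul_assoc (2 * m)]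
        gcongr

end MovingFrame

/-! ### Trial states -/

section WavePacket

variable {F : Type*} [NormedAddCommGroup F]

theorem MemH1.of_contDiff [NormedSpace ℝ F] {f : R3 → F} (hf : ContDiff ℝ 1 f)
    (hfc : HasCompactSupport f) : MemH1 f where
  memLp := hf.continuous.memLp_of_hasCompactSupport hfc
  memLp_deriv k := ⟨partialDeriv k f, .of_contDiff hf,
    (continuous_partialDeriv hf).memLp_of_hasCompactSupport (hasCompactSupport_partialDeriv hfc)⟩

theorem normSqL2_congr {f g : R3 → F} (h : f =ᵐ[volume] g) : normSqL2 f = normSqL2 g :=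
  integral_congr_ae (h.mono fun x hx => by simp only [hx])

theorem normSqL2_comp_inv_smul {r : ℝ} (hr : 0 ≤ r) (f : R3 → F) :
    normSqL2 (fun x => f (r⁻¹ • x)) = r ^ 3 * normSqL2 f := by
  rw [normSqL2, Measure.integral_comp_inv_smul volume (fun x => ‖f x‖ ^ 2) r, normSqL2]
  simp [abs_of_nonneg hr]

theorem normSqL2_const_mul (a : ℝ) (f : R3 → ℝ) :
    normSqL2 (fun x => a * f x) = a ^ 2 * normSqL2 f := by
  simp only [normSqL2, norm_mul, mul_pow, integral_const_mul, Real.norm_eq_abs, sq_abs]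

theorem normSqL2_cutoff {r : ℝ} (hr : 0 ≤ r) :
    normSqL2 (cutoff r : R3 → ℝ) = r ^ 3 * normSqL2 (cutoffBump : ContDiffBump (0 : R3)) :=
  normSqL2_comp_inv_smul hr _

theorem normSqL2_partialDeriv_cutoff {r : ℝ} (hr : 0 < r) (k : Fin 3) :
    normSqL2 (partialDeriv k (cutoff r)) =
      r * normSqL2 (partialDeriv k (cutoffBump : ContDiffBump (0 : R3))) := by
  have hscale : partialDeriv k (cutoff r) = fun x =>
      r⁻¹ * partialDeriv k (cutoffBump : ContDiffBump (0 : R3)) (r⁻¹ • x) := by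
    funext x
    rw [partialDeriv, fderiv_cutoff]
    rfl
  rw [hscale, normSqL2_const_mul, normSqL2_comp_inv_smul hr.le]
  field_simp

theorem normSqL2_cutoffBump_pos : 0 < normSqL2 (cutoffBump : ContDiffBump (0 : R3)) := by
  have hcont : Continuous fun x => ‖(cutoffBump : ContDiffBump (0 : R3)) x‖ ^ 2 :=
    cutoffBump.continuous.norm.pow 2
  refine hcont.integral_pos_of_hasCompactSupport_nonneg_nonzero (x := 0)
    (cutoffBump.hasCompactSupport.comp_left (g := fun t => ‖t‖ ^ 2) (by simp))
    (fun x => sq_nonneg _) ?_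
  rw [cutoffBump.one_of_mem_closedBall (Metric.mem_closedBall_self cutoffBump.rIn_pos.le)]
  simp

/-- The plane wave `exp(i p · x)` with constant spinor `(1, 0)`. -/
def planeWave (p x : R3) : C2 :=
  Complex.exp (Complex.I * (inner ℝ p x : ℝ)) • EuclideanSpace.single 0 (1 : ℂ)

theorem norm_planeWave (p x : R3) : ‖planeWave p x‖ = 1 := by
  rw [planeWave, norm_smul, mul_comm Complex.I, Complex.norm_exp_ofReal_mul_I]
  simp

theorem contDiff_planeWave (p : R3) : ContDiff ℝ 1 (planeWave p) :=
  (contDiff_const.mul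
    (Complex.ofRealCLM.contDiff.comp (contDiff_const.inner ℝ contDiff_id))).cexp.smul contDiff_const

theorem partialDeriv_planeWave (p : R3) (k : Fin 3) (x : R3) :
    partialDeriv k (planeWave p) x = (Complex.I * (p k : ℂ)) • planeWave p x := by
  have hphase : HasFDerivAt (fun x : R3 => ((inner ℝ p x : ℝ) : ℂ))
      (Complex.ofRealCLM.comp (innerSL ℝ p)) x :=
    Complex.ofRealCLM.hasFDerivAt.comp x (innerSL ℝ p).hasFDerivAt
  have hwave : HasFDerivAt (planeWave p) _ x :=
    (hphase.const_mul Complex.I).cexp.smul_const (EuclideanSpace.single 0 (1 : ℂ))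
  rw [partialDeriv, hwave.fderiv]
  simp [planeWave, smul_smul, EuclideanSpace.inner_single_right, mul_comm, mul_left_comm,
    mul_assoc]

/-- The plane wave with wave vector `p` and amplitude `a`, cut off at distance `r`. -/
def wavePacket (a : ℝ) (p : R3) (r : ℝ) (x : R3) : C2 := (a * cutoff r x) • planeWave p x

theorem contDiff_wavePacket (a : ℝ) (p : R3) (r : ℝ) : ContDiff ℝ 1 (wavePacket a p r) :=
  (contDiff_const.mul ((contDiff_cutoff r).of_le (by simp))).smul (contDiff_planeWave p)

theorem memH1_wavePacket (a : ℝ) (p : R3) {r : ℝ} (hr : 0 < r) : MemH1 (wavePacket a p r) :=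
  .of_contDiff (contDiff_wavePacket a p r) (hasCompactSupport_cutoff hr).mul_left.smul_right

theorem normSqL2_wavePacket (a : ℝ) (p : R3) {r : ℝ} (hr : 0 ≤ r) : normSqL2 (wavePacket a p r) =
    a ^ 2 * (r ^ 3 * normSqL2 (cutoffBump : ContDiffBump (0 : R3))) := by
  rw [← normSqL2_cutoff hr, ← normSqL2_const_mul]
  simp only [normSqL2, wavePacket, norm_smul, norm_planeWave, mul_one]

variable {ħ c Q : ℝ}

-- The phase is chosen so that its derivative cancels the constant potential.
theorem covDeriv_wavePacket_ae_eq {p w : R3} (hp : ħ • p = (Q / c) • w) (a r : ℝ) (k : Fin 3) :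
    covDeriv ħ c Q (fun _ => w) (wavePacket a p r) k =ᵐ[volume] fun x =>
      (Complex.I * ((ħ * a * partialDeriv k (cutoff r) x : ℝ) : ℂ)) • planeWave p x := by
  have hcutoff : ContDiff ℝ 1 fun x : R3 => a * cutoff r x :=
    contDiff_const.mul ((contDiff_cutoff r).of_le (by simp))
  have hphase : ħ * p k = Q / c * w k := congrArg (· k) hp
  filter_upwards [weakPartial_ae_eq (k := k) (.of_contDiff (contDiff_wavePacket a p r))] with x hx
  have hpartial : partialDeriv k (fun x : R3 => a * cutoff r x) x =
      a * partialDeriv k (cutoff r) x := by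
    rw [partialDeriv, fderiv_const_mul ((contDiff_cutoff r).differentiable (by simp) x)]
    rfl
  have hproduct : partialDeriv k (wavePacket a p r) x = _ :=
    partialDeriv_smul hcutoff (contDiff_planeWave p) x
  rw [covDeriv, hx, hproduct, hpartial, partialDeriv_planeWave, ← hphase, wavePacket]
  simp only [← Complex.coe_smul, smul_smul, ← add_smul]
  congr 1
  push_cast
  linear_combination (ħ * p k * a * cutoff r x : ℂ) * Complex.I_sq

theorem kineticNormSq_wavePacket {p w : R3} (hp : ħ • p = (Q / c) • w) (a : ℝ) {r : ℝ}
    (hr : 0 < r) : kineticNormSq ħ c Q .S (fun _ => w) (wavePacket a p r) =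
      (ħ * a) ^ 2 *
        (r * ∑ k, normSqL2 (partialDeriv k (cutoffBump : ContDiffBump (0 : R3)))) := by
  have hcov (k : Fin 3) : normSqL2 (covDeriv ħ c Q (fun _ => w) (wavePacket a p r) k) =
      (ħ * a) ^ 2 * (r * normSqL2 (partialDeriv k (cutoffBump : ContDiffBump (0 : R3)))) := by
    rw [normSqL2_congr (covDeriv_wavePacket_ae_eq hp a r k), ← normSqL2_partialDeriv_cutoff hr,
      ← normSqL2_const_mul]
    simp only [normSqL2, norm_smul, norm_mul, Complex.norm_I, one_mul, Complex.norm_real,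
      norm_planeWave, mul_one]
  simp only [kineticNormSq, hcov, Finset.mul_sum]

theorem exists_memH1_kineticNormSq_le (hħ : ħ ≠ 0) {lam : ℝ} (hlam : 0 < lam) (c Q : ℝ)
    (w : R3) {ε : ℝ} (hε : 0 < ε) : ∃ φ : R3 → C2, MemH1 φ ∧ normSqL2 φ = lam ∧
      kineticNormSq ħ c Q .S (fun _ => w) φ ≤ ε := by
  set I₀ := normSqL2 (cutoffBump : ContDiffBump (0 : R3))
  set I₁ := ∑ k, normSqL2 (partialDeriv k (cutoffBump : ContDiffBump (0 : R3)))
  have hI₀ : 0 < I₀ := normSqL2_cutoffBump_pos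
  have hlim : Tendsto (fun r : ℝ => ħ ^ 2 * lam * I₁ / I₀ / r ^ 2) atTop (𝓝 0) :=
    tendsto_const_nhds.div_atTop (tendsto_pow_atTop two_ne_zero)
  obtain ⟨r, hrε, hr⟩ := ((hlim.eventually_le_const hε).and (eventually_gt_atTop 0)).exists
  have hamplitude : √(lam / (r ^ 3 * I₀)) ^ 2 = lam / (r ^ 3 * I₀) := Real.sq_sqrt (by positivity)
  have hp : ħ • ħ⁻¹ • (Q / c) • w = (Q / c) • w := smul_inv_smul₀ hħ _
  refine ⟨wavePacket √(lam / (r ^ 3 * I₀)) (ħ⁻¹ • (Q / c) • w) r, memH1_wavePacket _ _ hr, ?_, ?_⟩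
  · rw [normSqL2_wavePacket _ _ hr.le, hamplitude]
    field_simp
    rfl
  · rw [kineticNormSq_wavePacket hp _ hr, mul_pow, hamplitude]
    refine le_trans (le_of_eq ?_) hrε
    field_simp
    rfl

end WavePacket

section ZeroField

theorem hasWeakPartial_zero {F : Type*} [NormedAddCommGroup F] [NormedSpace ℝ F] (k : Fin 3) :
    HasWeakPartial k (0 : R3 → F) 0 := by
  have hzero : partialDeriv k (0 : R3 → F) = 0 := by
    funext x
    simp [partialDeriv]
  have hsmooth : ContDiff ℝ 1 (0 : R3 → F) := contDiff_zero_fun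
  simpa only [hzero] using HasWeakPartial.of_contDiff (k := k) hsmooth

theorem ae_weakPartial_zero : ∀ᵐ x, ∀ k, weakPartial k (0 : R3 → R3) x = 0 :=
  ae_all_iff.2 fun k => weakPartial_ae_eq (hasWeakPartial_zero k)

theorem memD1_zero : MemD1 (0 : R3 → R3) where
  locallyIntegrable := locallyIntegrable_zero
  memLp_deriv k := ⟨0, hasWeakPartial_zero k, MemLp.zero⟩
  vanish t ht := by simp [ht.not_gt]

theorem div_zero_ae_eq : div (0 : R3 → R3) =ᵐ[volume] 0 := by
  filter_upwards [ae_weakPartial_zero] with x hx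
  simp [div, hx]

theorem curl_zero_ae_eq : curl (0 : R3 → R3) =ᵐ[volume] 0 := by
  filter_upwards [ae_weakPartial_zero] with x hx
  ext m
  fin_cases m <;> simp [curl, hx]

theorem gradNormSq_zero : gradNormSq (0 : R3 → R3) = 0 :=
  Finset.sum_eq_zero fun k _ => integral_eq_zero_of_ae <| by
    filter_upwards [ae_weakPartial_zero] with x hx
    simp [hx]

variable {ħ c m Q lam : ℝ}

theorem kineticNormSq_const (j : Model) {ψ : R3 → C2} (hψ : MemH1 ψ) (w : R3) :
    kineticNormSq ħ c Q j (fun _ => w) ψ = kineticNormSq ħ c Q .S (fun _ => w) ψ := by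
  cases j with
  | S => rfl
  | P =>
    have hcurl : ∫ x, inner ℝ (curl 0 x) (spin (ψ x)) = 0 := integral_eq_zero_of_ae <| by
      filter_upwards [curl_zero_ae_eq] with x hx
      simp [hx]
    simpa [hcurl] using kineticNormSq_P_eq (ħ := ħ) (c := c) (Q := Q) memD1_zero hψ w

theorem functional_zero_le (hc : c ≠ 0) (hm : m ≠ 0) (hQ : Q ≠ 0) (j : Model) {ψ : R3 → C2}
    (hψ : MemH1 ψ) (v : R3) :
    functional ħ c m Q j v ψ 0 ≤
      1 / (2 * m) * kineticNormSq ħ c Q .S (fun _ => boostPotential c m Q v) ψ -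
        m * ‖v‖ ^ 2 / 2 * normSqL2 ψ := by
  have hboosted : boosted c m Q v 0 = fun _ => boostPotential c m Q v := by
    funext x
    simp [boosted]
  have hdir := normSqL2_nonneg (dirDeriv (c⁻¹ • v) (0 : R3 → R3))
  rw [functional_eq_boosted hc hm hQ j hψ memD1_zero, hboosted, kineticNormSq_const j hψ,
    gradNormSq_zero, zero_sub, mul_neg]
  simp only [Pi.zero_apply, inner_zero_right, zero_mul, integral_zero, mul_zero, sub_zero]
  gcongr
  exact add_le_of_nonpos_right (neg_nonpos.2 (by positivity))

theorem IsMinimizer.functional_le (hħ : ħ ≠ 0) (hc : c ≠ 0) (hm : 0 < m) (hQ : Q ≠ 0)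
    (hlam : 0 < lam) {j : Model} {v : R3} {ψ : R3 → C2} {A : R3 → R3}
    (hmin : IsMinimizer ħ c m Q j lam v ψ A) :
    functional ħ c m Q j v ψ A ≤ -(m * ‖v‖ ^ 2 / 2 * lam) := by
  refine le_of_forall_pos_le_add fun ε hε => ?_
  obtain ⟨φ, hφ, hnorm, hkin⟩ := exists_memH1_kineticNormSq_le hħ hlam c Q
    (boostPotential c m Q v) (mul_pos (mul_pos two_pos hm) hε)
  have hφ_mem : (φ, 0) ∈ constraintSet lam := ⟨hφ, memD1_zero, hnorm, div_zero_ae_eq⟩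
  calc functional ħ c m Q j v ψ A
      ≤ functional ħ c m Q j v φ 0 := isMinOn_iff.1 hmin.2 (φ, 0) hφ_mem
    _ ≤ 1 / (2 * m) * (2 * m * ε) - m * ‖v‖ ^ 2 / 2 * lam := by
        refine (functional_zero_le hc hm.ne' hQ j hφ v).trans ?_
        rw [hnorm]
        gcongr
    _ = -(m * ‖v‖ ^ 2 / 2 * lam) + ε := by
        field_simp
        ring

end ZeroField

/-! ### The field energy and the interaction -/

section FieldEnergy

variable {F : Type*} [NormedAddCommGroup F] [NormedSpace ℝ F]

theorem norm_dirDeriv_sq_le (u : R3) (f : R3 → F) (x : R3) :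
    ‖dirDeriv u f x‖ ^ 2 ≤ ‖u‖ ^ 2 * ∑ k, ‖weakPartial k f x‖ ^ 2 :=
  calc ‖dirDeriv u f x‖ ^ 2 ≤ (∑ k, ‖u k‖ * ‖weakPartial k f x‖) ^ 2 := by
        simp only [← norm_smul]
        gcongr
        exact norm_sum_le _ _
    _ ≤ (∑ k, ‖u k‖ ^ 2) * ∑ k, ‖weakPartial k f x‖ ^ 2 := Finset.sum_mul_sq_le_sq_mul_sq _ _ _
    _ = ‖u‖ ^ 2 * ∑ k, ‖weakPartial k f x‖ ^ 2 := by rw [EuclideanSpace.norm_sq_eq]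

theorem norm_curl_sq_le (A : R3 → R3) (x : R3) :
    ‖curl A x‖ ^ 2 ≤ 2 * ∑ k, ‖weakPartial k A x‖ ^ 2 := by
  simp only [EuclideanSpace.norm_sq_eq, Fin.sum_univ_three, Real.norm_eq_abs, sq_abs, curl,
    Matrix.cons_val]
  generalize weakPartial 0 A x = p, weakPartial 1 A x = q, weakPartial 2 A x = r
  linarith [sq_nonneg (q 2 + r 1), sq_nonneg (r 0 + p 2), sq_nonneg (p 1 + q 0),
    sq_nonneg (p 0), sq_nonneg (q 1), sq_nonneg (r 2)]

variable [CompleteSpace F]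

theorem MemD1.integrable_sum_norm_weakPartial_sq {f : R3 → F} (hf : MemD1 f) :
    Integrable fun x => ∑ k, ‖weakPartial k f x‖ ^ 2 :=
  integrable_finsetSum _ fun k _ => (hf.memLp_weakPartial k).integrable_norm_pow two_ne_zero

theorem MemD1.integral_le_const_mul_gradNormSq {f : R3 → F} (hf : MemD1 f) {g : R3 → ℝ} {a : ℝ}
    (hg : 0 ≤ g) (hle : ∀ x, g x ≤ a * ∑ k, ‖weakPartial k f x‖ ^ 2) :
    ∫ x, g x ≤ a * gradNormSq f :=
  calc ∫ x, g x ≤ ∫ x, a * ∑ k, ‖weakPartial k f x‖ ^ 2 :=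
        integral_mono_of_nonneg (ae_of_all _ hg)
          (hf.integrable_sum_norm_weakPartial_sq.const_mul a) (ae_of_all _ hle)
    _ = a * gradNormSq f := by
        rw [integral_const_mul, integral_finsetSum _ fun k _ =>
          (hf.memLp_weakPartial k).integrable_norm_pow two_ne_zero]
        rfl

theorem MemD1.normSqL2_dirDeriv_le {f : R3 → F} (hf : MemD1 f) (u : R3) :
    normSqL2 (dirDeriv u f) ≤ ‖u‖ ^ 2 * gradNormSq f :=
  hf.integral_le_const_mul_gradNormSq (fun _ => sq_nonneg _) (norm_dirDeriv_sq_le u f)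

variable {A : R3 → R3}

theorem MemD1.normSqL2_curl_le (hA : MemD1 A) : normSqL2 (curl A) ≤ 2 * gradNormSq A :=
  hA.integral_le_const_mul_gradNormSq (fun _ => sq_nonneg _) (norm_curl_sq_le A)

theorem MemD1.integral_curl_add_dirDeriv_le (hA : MemD1 A) (u : R3) :
    ∫ x, (‖curl A x‖ ^ 2 + ‖dirDeriv u A x‖ ^ 2) ≤ (2 + ‖u‖ ^ 2) * gradNormSq A :=
  hA.integral_le_const_mul_gradNormSq (fun _ => by positivity) fun x => by
    rw [add_mul]
    exact add_le_add (norm_curl_sq_le A x) (norm_dirDeriv_sq_le u A x)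

theorem MemD1.memLp_curl (hA : MemD1 A) : MemLp (curl A) 2 :=
  MemLp.of_eval_piLp hA.memLp_curl_apply

end FieldEnergy

section Interaction

variable {A : R3 → R3} {ψ : R3 → C2}

theorem abs_integral_inner_mul_norm_sq_le (hψ : MemH1 ψ) (hA : MemLp A 6) (v : R3) :
    |∫ x, inner ℝ v (A x) * ‖ψ x‖ ^ 2| ≤
      ‖v‖ * (lpNorm A 6 volume * lpNorm ψ 3 volume * lpNorm ψ 2 volume) := by
  calc |∫ x, inner ℝ v (A x) * ‖ψ x‖ ^ 2|
      ≤ ∫ x, ‖v‖ * (‖A x‖ * ‖ψ x‖ * ‖ψ x‖) := by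
        rw [← Real.norm_eq_abs]
        refine norm_integral_le_of_norm_le
          (((hψ.memLp_norm_mul_norm hA).integrable_mul hψ.memLp.norm).const_mul ‖v‖)
          (ae_of_all _ fun x => ?_)
        rw [norm_mul, norm_pow, norm_norm, sq, mul_assoc ‖A x‖, ← mul_assoc ‖v‖]
        gcongr
        exact norm_inner_le_norm (𝕜 := ℝ) v (A x)
    _ ≤ ‖v‖ * (lpNorm A 6 volume * lpNorm ψ 3 volume * lpNorm ψ 2 volume) := by
        rw [integral_const_mul]
        gcongr
        exact integral_norm_mul_norm_mul_norm_le (s := 2) hA hψ.memLp_three hψ.memLp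

theorem abs_integral_inner_curl_spin_le (hψ : MemH1 ψ) (hA : MemD1 A) :
    |∫ x, inner ℝ (curl A x) (spin (ψ x))| ≤
      lpNorm ψ 6 volume * lpNorm ψ 3 volume * lpNorm (curl A) 2 volume := by
  calc |∫ x, inner ℝ (curl A x) (spin (ψ x))|
      ≤ ∫ x, ‖ψ x‖ * ‖ψ x‖ * ‖curl A x‖ := by
        rw [← Real.norm_eq_abs]
        refine norm_integral_le_of_norm_le
          ((hψ.memLp_norm_mul_norm hψ.memLp_six).integrable_mul hA.memLp_curl.norm)
          (ae_of_all _ fun x => ?_)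
        rw [← sq, ← norm_spin, mul_comm]
        exact norm_inner_le_norm (𝕜 := ℝ) _ _
    _ ≤ _ := integral_norm_mul_norm_mul_norm_le (s := 2) hψ.memLp_six hψ.memLp_three hA.memLp_curl

theorem lpNorm_two_eq_sqrt_normSqL2 {H : Type*} [NormedAddCommGroup H] {f : R3 → H}
    (hf : MemLp f 2) : lpNorm f 2 volume = √(normSqL2 f) := by
  rw [normSqL2_eq_lpNorm_sq hf.1, Real.sqrt_sq lpNorm_nonneg]

theorem lpNorm_three_le {C s : ℝ} (hψ : MemH1 ψ) (hs : 0 ≤ s)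
    (h6 : lpNorm ψ 6 volume ≤ C * s ^ 2) :
    lpNorm ψ 3 volume ≤ √(√(normSqL2 ψ) * C) * s :=
  calc lpNorm ψ 3 volume ≤ √(√(normSqL2 ψ) * C * s ^ 2) := by
        refine Real.le_sqrt_of_sq_le ((lpNorm_three_sq_le hψ.memLp hψ.memLp_six).trans ?_)
        rw [lpNorm_two_eq_sqrt_normSqL2 hψ.memLp, mul_assoc]
        gcongr
    _ = √(√(normSqL2 ψ) * C) * s := by
        rw [Real.sqrt_mul' _ (sq_nonneg s), Real.sqrt_sq hs]

end Interaction

section KineticBounds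

variable {ħ : ℝ}

theorem exists_lpNorm_le_of_kineticNormSq_eq (hħ : 0 < ħ) :
    ∃ C : ℝ, 0 < C ∧ ∀ (c Q : ℝ) (w : R3) (ψ : R3 → C2) (A : R3 → R3) (s : ℝ),
      MemH1 ψ → MemD1 A → 0 ≤ s → kineticNormSq ħ c Q .S (fun x => A x + w) ψ = s ^ 4 →
        lpNorm ψ 6 volume ≤ C * s ^ 2 ∧ lpNorm ψ 3 volume ≤ √(√(normSqL2 ψ) * C) * s := by
  obtain ⟨C, hC, hle⟩ := exists_lpNorm_six_le_kineticNormSq hħ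
  refine ⟨C, hC, fun c Q w ψ A s hψ hA hs hkin => ?_⟩
  have h6 := hle c Q _ ψ hψ (hψ.memLp_covDeriv hA.memLp_six w)
  rw [hkin, show s ^ 4 = (s ^ 2) ^ 2 by ring, Real.sqrt_sq (sq_nonneg s)] at h6
  exact ⟨h6, lpNorm_three_le hψ hs h6⟩

theorem exists_abs_integral_inner_mul_norm_sq_le (hħ : 0 < ħ) {lam : ℝ} (hlam : 0 < lam) :
    ∃ C : ℝ, 0 < C ∧ ∀ (c Q : ℝ) (v w : R3) (ψ : R3 → C2) (A : R3 → R3) (s : ℝ),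
      MemH1 ψ → MemD1 A → normSqL2 ψ = lam → 0 ≤ s →
        kineticNormSq ħ c Q .S (fun x => A x + w) ψ = s ^ 4 →
          |∫ x, inner ℝ v (A x) * ‖ψ x‖ ^ 2| ≤ C * ‖v‖ * √(gradNormSq A) * s := by
  obtain ⟨CA, hCA, hA6⟩ := exists_lpNorm_six_le_of_memD1 R3
  obtain ⟨Cψ, hCψ, hψle⟩ := exists_lpNorm_le_of_kineticNormSq_eq hħ
  refine ⟨CA * √(√lam * Cψ) * √lam, by positivity, fun c Q v w ψ A s hψ hA hnorm hs hkin => ?_⟩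
  obtain ⟨-, h3⟩ := hψle c Q w ψ A s hψ hA hs hkin
  have h6 := hA6 A hA
  rw [hnorm] at h3
  calc |∫ x, inner ℝ v (A x) * ‖ψ x‖ ^ 2|
      ≤ ‖v‖ * (lpNorm A 6 volume * lpNorm ψ 3 volume * lpNorm ψ 2 volume) :=
        abs_integral_inner_mul_norm_sq_le hψ hA.memLp_six v
    _ ≤ ‖v‖ * (CA * √(gradNormSq A) * (√(√lam * Cψ) * s) * √lam) := by
        rw [lpNorm_two_eq_sqrt_normSqL2 hψ.memLp, hnorm]
        gcongr
        exact lpNorm_nonneg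
    _ = CA * √(√lam * Cψ) * √lam * ‖v‖ * √(gradNormSq A) * s := by ring

theorem exists_abs_integral_inner_curl_spin_le (hħ : 0 < ħ) (lam : ℝ) :
    ∃ C : ℝ, 0 ≤ C ∧ ∀ (c Q : ℝ) (w : R3) (ψ : R3 → C2) (A : R3 → R3) (s : ℝ),
      MemH1 ψ → MemD1 A → normSqL2 ψ = lam → 0 ≤ s →
        kineticNormSq ħ c Q .S (fun x => A x + w) ψ = s ^ 4 →
          |∫ x, inner ℝ (curl A x) (spin (ψ x))| ≤ C * √(gradNormSq A) * s ^ 3 := by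
  obtain ⟨Cψ, hCψ, hψle⟩ := exists_lpNorm_le_of_kineticNormSq_eq hħ
  refine ⟨Cψ * √(√lam * Cψ) * √2, by positivity, fun c Q w ψ A s hψ hA hnorm hs hkin => ?_⟩
  obtain ⟨h6, h3⟩ := hψle c Q w ψ A s hψ hA hs hkin
  have hcurl : lpNorm (curl A) 2 volume ≤ √2 * √(gradNormSq A) := by
    rw [← Real.sqrt_mul zero_le_two]
    refine Real.le_sqrt_of_sq_le ?_
    rw [← normSqL2_eq_lpNorm_sq hA.memLp_curl.1]
    exact hA.normSqL2_curl_le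
  rw [hnorm] at h3
  calc |∫ x, inner ℝ (curl A x) (spin (ψ x))|
      ≤ lpNorm ψ 6 volume * lpNorm ψ 3 volume * lpNorm (curl A) 2 volume :=
        abs_integral_inner_curl_spin_le hψ hA
    _ ≤ Cψ * s ^ 2 * (√(√lam * Cψ) * s) * (√2 * √(gradNormSq A)) := by
        gcongr <;> exact lpNorm_nonneg
    _ = Cψ * √(√lam * Cψ) * √2 * √(gradNormSq A) * s ^ 3 := by ring

variable {c Q : ℝ} {A : R3 → R3} {ψ : R3 → C2}

theorem kineticNormSq_S_le (hħ : 0 ≤ ħ) (j : Model) (hA : MemD1 A) (hψ : MemH1 ψ) (w : R3) :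
    kineticNormSq ħ c Q .S (fun x => A x + w) ψ ≤ kineticNormSq ħ c Q j (fun x => A x + w) ψ +
      ħ * |Q / c| * |∫ x, inner ℝ (curl A x) (spin (ψ x))| := by
  cases j with
  | S => exact le_add_of_nonneg_right (by positivity)
  | P =>
    have habs := le_abs_self (ħ * (Q / c) * ∫ x, inner ℝ (curl A x) (spin (ψ x)))
    rw [abs_mul, abs_mul, abs_of_nonneg hħ] at habs
    rw [kineticNormSq_P_eq hA hψ]
    linarith

end KineticBounds

section Bootstrap

variable {α β a b x y s P : ℝ}

theorem le_of_mul_sq_le (hβ : 0 < β) (ha : 0 ≤ a) (hx : 0 ≤ x) (hy : 0 ≤ y) (hs : 0 ≤ s)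
    (hle : β * y ^ 2 ≤ a * x * y * s) : y ≤ a / β * x * s := by
  rcases hy.eq_or_lt with rfl | hy
  · positivity
  · rw [div_mul_eq_mul_div, div_mul_eq_mul_div, le_div_iff₀ hβ]
    exact le_of_mul_le_mul_right (by linarith) hy

theorem bounds_of_energy_le_of_pow_four_le {K : ℝ} (hα : 0 < α) (hβ : 0 < β) (ha : 0 ≤ a)
    (hb : 0 ≤ b) (hx : 0 ≤ x) (hy : 0 ≤ y) (hs : 0 ≤ s) (hP : 0 ≤ P)
    (henergy : α * P + β * y ^ 2 ≤ a * x * y * s) (hkin : s ^ 4 ≤ P + b * y * s ^ 3)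
    (hsmall : b * (a / β) * x ≤ 1 / 2) (hK : K = 2 * (a ^ 2 / (α * β))) :
    s ^ 2 ≤ K * x ^ 2 ∧ y ^ 2 ≤ (a / β) ^ 2 * K * x ^ 4 ∧ P ≤ K ^ 2 / 2 * x ^ 4 := by
  have hy_le : y ≤ a / β * x * s :=
    le_of_mul_sq_le hβ ha hx hy hs ((le_add_of_nonneg_left (by positivity)).trans henergy)
  have hP_le : P ≤ K / 2 * x ^ 2 * s ^ 2 := by
    have hαP : α * P ≤ a * x * (a / β * x * s) * s :=
      calc α * P ≤ a * x * y * s := (le_add_of_nonneg_right (by positivity)).trans henergy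
        _ ≤ a * x * (a / β * x * s) * s := by gcongr
    calc P ≤ a * x * (a / β * x * s) * s / α := (le_div_iff₀' hα).2 hαP
      _ = K / 2 * x ^ 2 * s ^ 2 := by
          rw [hK]
          field_simp
  have hs_le : s ^ 2 ≤ K * x ^ 2 := by
    have habsorb : b * y * s ^ 3 ≤ 1 / 2 * s ^ 4 :=
      calc b * y * s ^ 3 ≤ b * (a / β * x * s) * s ^ 3 := by gcongr
        _ = b * (a / β) * x * s ^ 4 := by ring
        _ ≤ 1 / 2 * s ^ 4 := by gcongr
    rcases hs.eq_or_lt with rfl | hs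
    · rw [zero_pow two_ne_zero, hK]
      positivity
    · exact le_of_mul_le_mul_right (by linarith) (pow_pos hs 2)
  have hK0 : 0 ≤ K := hK ▸ by positivity
  refine ⟨hs_le, ?_, ?_⟩
  · calc y ^ 2 ≤ (a / β * x * s) ^ 2 := by gcongr
      _ = (a / β) ^ 2 * x ^ 2 * s ^ 2 := by ring
      _ ≤ (a / β) ^ 2 * x ^ 2 * (K * x ^ 2) := by gcongr
      _ = (a / β) ^ 2 * K * x ^ 4 := by ring
  · calc P ≤ K / 2 * x ^ 2 * s ^ 2 := hP_le
      _ ≤ K / 2 * x ^ 2 * (K * x ^ 2) := by gcongr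
      _ = K ^ 2 / 2 * x ^ 4 := by ring

end Bootstrap

section Minimizer

variable {ħ c m Q lam : ℝ}

theorem IsMinimizer.energy_le (hħ : ħ ≠ 0) (hc : 0 < c) (hm : 0 < m) (hQ : Q ≠ 0)
    (hlam : 0 < lam) {j : Model} {v : R3} {ψ : R3 → C2} {A : R3 → R3} (hvc : ‖v‖ ≤ c / 2)
    (hmin : IsMinimizer ħ c m Q j lam v ψ A) :
    1 / (2 * m) * kineticNormSq ħ c Q j (boosted c m Q v A) ψ +
        1 / (16 * Real.pi) * gradNormSq A ≤
      |Q / c| * |∫ x, inner ℝ v (A x) * ‖ψ x‖ ^ 2| := by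
  obtain ⟨hψ : MemH1 ψ, hA : MemD1 A, hnorm : normSqL2 ψ = lam, -⟩ := hmin.1
  have hle := hmin.functional_le hħ hc.ne' hm hQ hlam
  rw [functional_eq_boosted hc.ne' hm.ne' hQ j hψ hA, hnorm] at hle
  have hinteraction := le_abs_self (Q / c * ∫ x, inner ℝ v (A x) * ‖ψ x‖ ^ 2)
  rw [abs_mul] at hinteraction
  have hspeed : ‖c⁻¹ • v‖ ≤ 1 / 2 := by
    rw [norm_smul, norm_inv, Real.norm_of_nonneg hc.le, inv_mul_le_iff₀ hc]
    linarith
  have hdir : normSqL2 (dirDeriv (c⁻¹ • v) A) ≤ 1 / 2 * gradNormSq A := by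
    refine (hA.normSqL2_dirDeriv_le (c⁻¹ • v)).trans ?_
    have := gradNormSq_nonneg A
    gcongr
    nlinarith [norm_nonneg (c⁻¹ • v)]
  have hfield : 1 / (16 * Real.pi) * gradNormSq A ≤
      1 / (8 * Real.pi) * (gradNormSq A - normSqL2 (dirDeriv (c⁻¹ • v) A)) :=
    calc 1 / (16 * Real.pi) * gradNormSq A
        = 1 / (8 * Real.pi) * (gradNormSq A - 1 / 2 * gradNormSq A) := by
          field_simp
          ring
      _ ≤ _ := by gcongr
  linarith

end Minimizer

section EnergyExpansion

variable {ħ c m Q lam : ℝ}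

theorem exists_isMinimizer_inequalities (hħ : 0 < ħ) (hc : 0 < c) (hm : 0 < m) (hQ : Q ≠ 0)
    (j : Model) (hlam : 0 < lam) : ∃ a b : ℝ, 0 < a ∧ 0 ≤ b ∧
      ∀ (v : R3) (ψ : R3 → C2) (A : R3 → R3) (s : ℝ), ‖v‖ ≤ c / 2 →
        IsMinimizer ħ c m Q j lam v ψ A → 0 ≤ s →
          kineticNormSq ħ c Q .S (boosted c m Q v A) ψ = s ^ 4 →
            1 / (2 * m) * kineticNormSq ħ c Q j (boosted c m Q v A) ψ +
                1 / (16 * Real.pi) * √(gradNormSq A) ^ 2 ≤ a * ‖v‖ * √(gradNormSq A) * s ∧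
              s ^ 4 ≤ kineticNormSq ħ c Q j (boosted c m Q v A) ψ +
                b * √(gradNormSq A) * s ^ 3 := by
  obtain ⟨C₁, hC₁, hinteraction⟩ := exists_abs_integral_inner_mul_norm_sq_le hħ hlam
  obtain ⟨C₂, hC₂, hspin⟩ := exists_abs_integral_inner_curl_spin_le hħ lam
  refine ⟨|Q / c| * C₁, ħ * |Q / c| * C₂, by positivity, by positivity,
    fun v ψ A s hv hmin hs hkin => ?_⟩
  obtain ⟨hψ : MemH1 ψ, hA : MemD1 A, hnorm : normSqL2 ψ = lam, -⟩ := hmin.1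
  have hI := hinteraction c Q v (boostPotential c m Q v) ψ A s hψ hA hnorm hs hkin
  have hC := hspin c Q (boostPotential c m Q v) ψ A s hψ hA hnorm hs hkin
  rw [Real.sq_sqrt (gradNormSq_nonneg A)]
  constructor
  · calc _ ≤ |Q / c| * |∫ x, inner ℝ v (A x) * ‖ψ x‖ ^ 2| := hmin.energy_le hħ.ne' hc hm hQ hlam hv
      _ ≤ |Q / c| * (C₁ * ‖v‖ * √(gradNormSq A) * s) := by gcongr
      _ = _ := by ring
  · calc s ^ 4 = kineticNormSq ħ c Q .S (boosted c m Q v A) ψ := hkin.symm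
      _ ≤ kineticNormSq ħ c Q j (boosted c m Q v A) ψ +
            ħ * |Q / c| * |∫ x, inner ℝ (curl A x) (spin (ψ x))| :=
          kineticNormSq_S_le hħ.le j hA hψ (boostPotential c m Q v)
      _ ≤ kineticNormSq ħ c Q j (boosted c m Q v A) ψ +
            ħ * |Q / c| * (C₂ * √(gradNormSq A) * s ^ 3) := by gcongr
      _ = _ := by ring

theorem exists_isMinimizer_bounds (hħ : 0 < ħ) (hc : 0 < c) (hm : 0 < m) (hQ : Q ≠ 0)
    (j : Model) (hlam : 0 < lam) : ∃ θ K L : ℝ, 0 < θ ∧ 0 < K ∧ 0 < L ∧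
      ∀ (v : R3) (ψ : R3 → C2) (A : R3 → R3), ‖v‖ < θ → IsMinimizer ħ c m Q j lam v ψ A →
        √(kineticNormSq ħ c Q .S (boosted c m Q v A) ψ) ≤ K * ‖v‖ ^ 2 ∧
          gradNormSq A ≤ L * ‖v‖ ^ 4 ∧
            kineticNormSq ħ c Q j (boosted c m Q v A) ψ ≤ K ^ 2 / 2 * ‖v‖ ^ 4 := by
  obtain ⟨a, b, ha, hb, hineq⟩ := exists_isMinimizer_inequalities hħ hc hm hQ j hlam
  set α := 1 / (2 * m)
  set β := 1 / (16 * Real.pi)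
  have hα : 0 < α := by positivity
  have hβ : 0 < β := by positivity
  refine ⟨min (c / 2) (1 / (2 * (b * (a / β) + 1))), 2 * (a ^ 2 / (α * β)),
    (a / β) ^ 2 * (2 * (a ^ 2 / (α * β))), by positivity, by positivity, by positivity,
    fun v ψ A hv hmin => ?_⟩
  obtain ⟨hvc, hvθ⟩ := lt_min_iff.1 hv
  have hsmall : b * (a / β) * ‖v‖ ≤ 1 / 2 := by
    rw [lt_div_iff₀ (by positivity)] at hvθ
    linarith [norm_nonneg v]
  set S := kineticNormSq ħ c Q .S (boosted c m Q v A) ψ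
  have hroot : S = √√S ^ 4 := by
    rw [show √√S ^ 4 = (√√S ^ 2) ^ 2 by ring, Real.sq_sqrt (Real.sqrt_nonneg S),
      Real.sq_sqrt (kineticNormSq_nonneg ..)]
  obtain ⟨henergy, hkin⟩ := hineq v ψ A _ hvc.le hmin (Real.sqrt_nonneg _) hroot
  have hbounds := bounds_of_energy_le_of_pow_four_le hα hβ ha.le hb (norm_nonneg v)
    (Real.sqrt_nonneg _) (Real.sqrt_nonneg _) (kineticNormSq_nonneg ..) henergy hkin hsmall rfl
  rwa [Real.sq_sqrt (Real.sqrt_nonneg S), Real.sq_sqrt (gradNormSq_nonneg A)] at hbounds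

theorem abs_energy_sub_le (hc : 0 < c) (hm : 0 < m) (hQ : Q ≠ 0) (j : Model) {ψ : R3 → C2}
    {A : R3 → R3} (hψ : MemH1 ψ) (hA : MemD1 A) {v : R3} (hvc : ‖v‖ ≤ c) :
    |energy ħ c m Q j v ψ A - m * ‖v‖ ^ 2 / 2 * normSqL2 ψ| ≤
      1 / (2 * m) * (kineticNormSq ħ c Q j (boosted c m Q v A) ψ + 2 * m * ‖v‖ *
        (√(normSqL2 ψ) * √(kineticNormSq ħ c Q .S (boosted c m Q v A) ψ))) +
          1 / (8 * Real.pi) * (3 * gradNormSq A) * normSqL2 ψ := by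
  set W := ∫ x, (‖curl A x‖ ^ 2 + ‖dirDeriv (c⁻¹ • v) A x‖ ^ 2)
  have : 0 ≤ W := integral_nonneg fun x => by positivity
  have hN := normSqL2_nonneg ψ
  have hspeed : ‖c⁻¹ • v‖ ≤ 1 := by
    rwa [norm_smul, norm_inv, Real.norm_of_nonneg hc.le, inv_mul_le_iff₀ hc, mul_one]
  have hW : W ≤ 3 * gradNormSq A := by
    refine (hA.integral_curl_add_dirDeriv_le (c⁻¹ • v)).trans ?_
    have := gradNormSq_nonneg A
    gcongr
    linarith [pow_le_one₀ (n := 2) (norm_nonneg _) hspeed]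
  calc |energy ħ c m Q j v ψ A - m * ‖v‖ ^ 2 / 2 * normSqL2 ψ|
      = |1 / (2 * m) * (kineticNormSq ħ c Q j A ψ - m ^ 2 * ‖v‖ ^ 2 * normSqL2 ψ) +
          1 / (8 * Real.pi) * W * normSqL2 ψ| := by
        rw [show energy ħ c m Q j v ψ A = 1 / (2 * m) * kineticNormSq ħ c Q j A ψ +
          1 / (8 * Real.pi) * W * normSqL2 ψ from rfl]
        congr 1
        field_simp
        ring
    _ ≤ 1 / (2 * m) * |kineticNormSq ħ c Q j A ψ - m ^ 2 * ‖v‖ ^ 2 * normSqL2 ψ| +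
          1 / (8 * Real.pi) * W * normSqL2 ψ := by
        refine (abs_add_le _ _).trans_eq ?_
        rw [abs_mul, abs_of_pos (by positivity : 0 < 1 / (2 * m)),
          abs_of_nonneg (by positivity : 0 ≤ 1 / (8 * Real.pi) * W * normSqL2 ψ)]
    _ ≤ _ := by
        gcongr
        exact abs_kineticNormSq_sub_le hc.ne' hm.le hQ j hψ hA v

end EnergyExpansion

end TravellingWave

end

theorem mainTheorem4 (ħ c m Q : ℝ) (hħ : 0 < ħ) (hc : 0 < c) (hm : 0 < m) (hQ : Q ≠ 0)
    (j : TravellingWave.Model) (lam : ℝ) (hlam : 0 < lam) :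
    ∃ θ κ : ℝ, 0 < θ ∧ 0 < κ ∧
      ∀ v : TravellingWave.R3, 0 < ‖v‖ → ‖v‖ < θ →
        ∀ (ψ : TravellingWave.R3 → TravellingWave.C2)
          (A : TravellingWave.R3 → TravellingWave.R3),
          TravellingWave.IsMinimizer ħ c m Q j lam v ψ A →
            |TravellingWave.energy ħ c m Q j v ψ A - m * ‖v‖ ^ 2 / 2 * lam| ≤ κ * ‖v‖ ^ 3 := by
  obtain ⟨θ, K, L, hθ, hK, hL, hbounds⟩ :=
    TravellingWave.exists_isMinimizer_bounds hħ hc hm hQ j hlam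
  refine ⟨min θ (min 1 c), 1 / (2 * m) * (K ^ 2 / 2 + 2 * m * (√lam * K)) +
    1 / (8 * Real.pi) * (3 * L) * lam, by positivity, by positivity, fun v _ hv ψ A hmin => ?_⟩
  simp only [lt_min_iff] at hv
  obtain ⟨hs, hy, hP⟩ := hbounds v ψ A hv.1 hmin
  have hcubic : ‖v‖ ^ 4 ≤ ‖v‖ ^ 3 :=
    pow_le_pow_of_le_one (norm_nonneg v) hv.2.1.le (by norm_num)
  have henergy := TravellingWave.abs_energy_sub_le (ħ := ħ) hc hm hQ j hmin.1.1 hmin.1.2.1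
    hv.2.2.le
  simp only [hmin.1.2.2.1] at henergy
  calc |TravellingWave.energy ħ c m Q j v ψ A - m * ‖v‖ ^ 2 / 2 * lam|
      ≤ _ := henergy
    _ ≤ 1 / (2 * m) * (K ^ 2 / 2 * ‖v‖ ^ 3 + 2 * m * ‖v‖ * (√lam * (K * ‖v‖ ^ 2))) +
          1 / (8 * Real.pi) * (3 * (L * ‖v‖ ^ 3)) * lam := by
        gcongr
        · exact hP.trans (by gcongr)
        · exact hy.trans (by gcongr)
    _ = _ := by ring
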